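/- Let $G=(V,E)$ be a finite, connected, simple, undirected graph with a (not necessarily proper) node coloring $col:V\to C$. For a set $W\subseteq V$ and a color $c\in C$ let $\Gamma(W,c)$ be the set of all nodes of color $c$ that can be reached from some $w\in W$ by a path with at least one edge on which all nodes after $w$ have color $c$. A color sequence $\gamma_1,\dots,\gamma_b$ started on $W_1=\{v_0\}$ yields the sets $W_{i+1}=W_i\cup\Gamma(W_i,\gamma_i)$ for $1\le i\le b$, and it conquers $W_{b+1}$. Honey-Bee-Solitaire is the following decision problem: given $G$, $C$, $col$, a start node $v_0\in V$ and a bound $b\in\mathbb{N}$ (in binary), is there a color sequence of length $b$ that conquers $V$ when started on $\{v_0\}$? A co-comparability graph is a graph whose nodes carry a partial order such that two distinct nodes are adjacent if and only if they are incomparable. Theorem. Honey-Bee-Solitaire can be solved in polynomial time on co-comparability graphs, for an arbitrary start node. That is, there are a deterministic algorithm (on a uniform-cost random access machine whose arithmetic consists of addition and truncated subtraction, a model polynomially equivalent to Turing machines) and a polynomial $p$ such that for every instance in which $G$ is a connected co-comparability graph, given by its adjacency matrix only (without a partial order), the algorithm halts after at most $p(s)$ steps with the correct answer, where $s$ is the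 bit length of the instance. -/

import Mathlib

noncomputable section

namespace HoneyBee

/-! ### The game -/

/-- The color-`c`-neighborhood of a node `v`: all nodes `u` that can be reached from `v` by a
nonempty sequence of edges, each of which leads into a node of color `c`. These are the nodes of
color `c` that are adjacent to `v`, or connected to `v` by a path of nodes of color `c`. -/
def nodeNbhd {V C : Type*} (G : SimpleGraph V) (col : V → C) (v : V) (c : C) : Set V :=
  {u | Relation.TransGen (fun x y => G.Adj x y ∧ col y = c) v u}

/-- The color-`c`-neighborhood of a set `W` of nodes. -/
def setNbhd {V C : Type*} (G : SimpleGraph V) (col : V → C) (W : Set V) (c : C) : Set V :=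
  ⋃ w ∈ W, nodeNbhd G col w c

/-- The node set conquered by the color sequence `γ` started on `W`: the colors are called one
after the other, and calling `c` replaces the territory `W` by its union with the
color-`c`-neighborhood of `W`. -/
def conquered {V C : Type*} (G : SimpleGraph V) (col : V → C) (W : Set V) (γ : List C) : Set V :=
  γ.foldl (fun W c => W ∪ setNbhd G col W c) W

/-- A co-comparability graph: its nodes carry a partial order such that two different nodes are
adjacent exactly if they are incomparable. -/
def IsCocomparability {V : Type*} (G : SimpleGraph V) : Prop :=
  ∃ P : PartialOrder V, ∀ u v : V, G.Adj u v ↔ u ≠ v ∧ ¬ P.lt u v ∧ ¬ P.lt v u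

/-- An instance of Honey-Bee-Solitaire: a graph on the nodes `0, …, n - 1`, a (not necessarily
proper) coloring with the colors `0, …, k - 1`, a start node and a bound. -/
structure Instance where
  n : ℕ
  k : ℕ
  graph : SimpleGraph (Fin n)
  col : Fin n → Fin k
  start : Fin n
  bound : ℕ

/-- The answer is YES: some color sequence of length `bound` conquers all nodes when it is started
on the start node. -/
def Instance.IsYes (I : Instance) : Prop :=
  ∃ γ : List (Fin I.k), γ.length = I.bound ∧
    conquered I.graph I.col {I.start} γ = Set.univ

/-- The number of bits of the instance: the adjacency matrix (`n * n` bits), the color of each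
node, and the numbers `n`, `k`, the start node and the bound in binary. -/
def Instance.size (I : Instance) : ℕ :=
  I.n * I.n + I.n * Nat.size I.k + Nat.size I.n + Nat.size I.k + Nat.size I.n + Nat.size I.bound

/-! ### Random access machines

Deterministic structured programs over natural numbers, with scalar variables and
two-dimensional arrays. Arithmetic consists of addition and truncated subtraction only (no
multiplication), so that `t` steps can lengthen a number by at most `t` bits. Hence the uniform
cost measure below is polynomially related to the running time of Turing machines. -/

/-- The memory: the values of the scalar variables `0, 1, 2, …` and the entries of the
two-dimensional arrays `0, 1, 2, …`. -/
structure Memory where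
  var : ℕ → ℕ
  arr : ℕ → ℕ → ℕ → ℕ

/-- Writing a scalar variable. -/
def Memory.setVar (m : Memory) (x a : ℕ) : Memory where
  var y := if y = x then a else m.var y
  arr := m.arr

/-- Writing an entry of an array. -/
def Memory.setArr (m : Memory) (A i j a : ℕ) : Memory where
  var := m.var
  arr B i' j' := if B = A ∧ i' = i ∧ j' = j then a else m.arr B i' j'

/-- Expressions: constants, variables, array entries, sums, and truncated differences. -/
inductive Expr where
  | lit (a : ℕ)
  | var (x : ℕ)
  | arr (A : ℕ) (i j : Expr)
  | add (e f : Expr)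
  | sub (e f : Expr)

/-- The value of an expression. -/
def Expr.eval (m : Memory) : Expr → ℕ
  | .lit a => a
  | .var x => m.var x
  | .arr A i j => m.arr A (i.eval m) (j.eval m)
  | .add e f => e.eval m + f.eval m
  | .sub e f => e.eval m - f.eval m

/-- The cost of evaluating an expression: one step for each operation, constant and variable. -/
def Expr.cost : Expr → ℕ
  | .lit _ => 1
  | .var _ => 1
  | .arr _ i j => i.cost + j.cost + 1
  | .add e f => e.cost + f.cost + 1
  | .sub e f => e.cost + f.cost + 1

/-- Programs. A condition `e` counts as true if its value is not `0`. -/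
inductive Prog where
  | skip
  | setVar (x : ℕ) (e : Expr)
  | setArr (A : ℕ) (i j e : Expr)
  | seq (p q : Prog)
  | cond (e : Expr) (p q : Prog)
  | loop (e : Expr) (p : Prog)

/-- `Exec p m m' t`: the program `p`, started in the memory `m`, halts after exactly `t` steps in
the memory `m'`. -/
inductive Exec : Prog → Memory → Memory → ℕ → Prop
  | skip (m : Memory) : Exec .skip m m 1
  | setVar (m : Memory) (x : ℕ) (e : Expr) :
      Exec (.setVar x e) m (m.setVar x (e.eval m)) (e.cost + 1)
  | setArr (m : Memory) (A : ℕ) (i j e : Expr) :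
      Exec (.setArr A i j e) m (m.setArr A (i.eval m) (j.eval m) (e.eval m))
        (i.cost + j.cost + e.cost + 1)
  | seq {m m' m'' : Memory} {p q : Prog} {s t : ℕ} :
      Exec p m m' s → Exec q m' m'' t → Exec (.seq p q) m m'' (s + t)
  | condTrue {m m' : Memory} {e : Expr} {p q : Prog} {t : ℕ} :
      e.eval m ≠ 0 → Exec p m m' t → Exec (.cond e p q) m m' (e.cost + t + 1)
  | condFalse {m m' : Memory} {e : Expr} {p q : Prog} {t : ℕ} :
      e.eval m = 0 → Exec q m m' t → Exec (.cond e p q) m m' (e.cost + t + 1)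
  | loopStep {m m' m'' : Memory} {e : Expr} {p : Prog} {s t : ℕ} :
      e.eval m ≠ 0 → Exec p m m' s → Exec (.loop e p) m' m'' t →
      Exec (.loop e p) m m'' (e.cost + s + t + 1)
  | loopEnd {m : Memory} {e : Expr} {p : Prog} :
      e.eval m = 0 → Exec (.loop e p) m m (e.cost + 1)

open Classical in
/-- The initial memory: variables `0, 1, 2, 3` hold the number of nodes, the number of colors, the
start node and the bound; array `0` holds the adjacency matrix, and array `1` holds the color of
node `i` at position `(i, 0)`. Everything else is `0`. -/
def Instance.memory (I : Instance) : Memory where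
  var x :=
    if x = 0 then I.n
    else if x = 1 then I.k
    else if x = 2 then I.start
    else if x = 3 then I.bound
    else 0
  arr A i j :=
    if A = 0 then
      if ∃ (hi : i < I.n) (hj : j < I.n), I.graph.Adj ⟨i, hi⟩ ⟨j, hj⟩ then 1 else 0
    else if A = 1 then
      if h : i < I.n ∧ j = 0 then I.col ⟨i, h.1⟩ else 0
    else 0

open Classical in
/-- Honey-Bee-Solitaire can be solved in polynomial time on the instances with property `S`: there
are a single program and a polynomial such that on every instance with property `S` the program
halts, after a number of steps bounded by the polynomial in the size of the instance, with the
correct answer (`1` for YES, `0` for NO) in variable `0`. Nothing is required on other inputs. -/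
def SolvableInPolyTimeOn (S : Instance → Prop) : Prop :=
  ∃ (prog : Prog) (p : Polynomial ℕ), ∀ I : Instance, S I →
    ∃ (m : Memory) (t : ℕ), Exec prog I.memory m t ∧ t ≤ p.eval I.size ∧
      m.var 0 = if I.IsYes then 1 else 0

end HoneyBee

end

/-! Contract every monochromatic component of the graph without `v₀` to a block, keeping `v₀` as a
block of its own. A call of color `c` then adds exactly the blocks of color `c` that touch the
territory. Contraction preserves co-comparability: two blocks that do not touch are comparable as a
whole (`exists_blockOrder`).

The territory stays connected, so it touches everything between its upper and its lower end. It
therefore suffices to follow a pair `(u, d)` of conquered nodes, starting from `(v₀, v₀)`. A node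
`x` can be missed by a connected territory containing `u` and `d` only if some path from `u` to `d`
avoids touching `x`; such a path lies entirely on one side of `x` (`Avoid.lt_or_lt`).

Every color occurring outside `v₀` has to be completed once, and these calls are charged separately.
A move is free if its color is certain to be completed by the call, and costs at most one otherwise.
A conquering sequence of length `b` then exists if and only if some move sequence reaches a goal
pair with cost plus number of colors at most `b`. From moves to calls, a free move either completes
a new color or can be omitted (`exists_calls_of_moveSeq`). From calls to moves, the ends are kept
beyond any two prescribed conquered nodes; when a call completes a color, they can be chosen such
that no node of that color lies outside them, so the move is free (`exists_moveSeq_of_calls`).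
Ineffective calls are dropped and the others enlarge the territory, so at most `n` moves are needed.

This is a shortest path problem on pairs of nodes, solved by `n` rounds of Bellman–Ford. Costs and
goals are expressed by touching and avoiding paths alone, both computable by transitive closure; the
partial order enters only the correctness proof. The program is a nest of loops up to `n`, whose
running time is bounded by a polynomial read off from its syntax. -/

namespace HoneyBee

/-! ### Loop programs -/

/-- Programs that write arrays, and whose only loops let a variable run from `0` to the value of
variable `0`. -/
inductive LoopProg where
  | setArr (A : ℕ) (i j e : Expr)
  | seq (p q : LoopProg)
  | when (e : Expr) (p : LoopProg)
  | loop (x : ℕ) (p : LoopProg)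

namespace LoopProg

/-- Translation into programs of the random access machine. -/
def toProg : LoopProg → Prog
  | .setArr A i j e => .setArr A i j e
  | .seq p q => .seq p.toProg q.toProg
  | .when e p => .cond e p.toProg .skip
  | .loop x p => .seq (.setVar x (.lit 0)) (.loop (.sub (.var 0) (.var x))
      (.seq p.toProg (.setVar x (.add (.var x) (.lit 1)))))

/-- The memory after `j` rounds of a loop with body `f` and variable `x`. -/
def iter (f : Memory → Memory) (x : ℕ) (m : Memory) : ℕ → Memory
  | 0 => m.setVar x 0
  | j + 1 => (f (iter f x m j)).setVar x (j + 1)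

/-- The memory in which a loop program halts. -/
def den : LoopProg → Memory → Memory
  | .setArr A i j e, m => m.setArr A (i.eval m) (j.eval m) (e.eval m)
  | .seq p q, m => q.den (p.den m)
  | .when e p, m => if e.eval m ≠ 0 then p.den m else m
  | .loop x p, m => iter p.den x m (m.var 0)

/-- The loop variables. -/
def vars : LoopProg → List ℕ
  | .setArr _ _ _ _ => []
  | .seq p q => p.vars ++ q.vars
  | .when _ p => p.vars
  | .loop x p => x :: p.vars

/-- The arrays that are written. -/
def arrs : LoopProg → List ℕ
  | .setArr A _ _ _ => [A]
  | .seq p q => p.arrs ++ q.arrs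
  | .when _ p => p.arrs
  | .loop _ p => p.arrs

/-- No loop body changes the variable or the bound of its loop. -/
def wf : LoopProg → Bool
  | .setArr _ _ _ _ => true
  | .seq p q => p.wf && q.wf
  | .when _ p => p.wf
  | .loop x p => decide (x ≠ 0) && decide (x ∉ p.vars) && p.wf

/-- A bound on the number of steps, as a polynomial in the value of variable `0`. -/
noncomputable def bound : LoopProg → Polynomial ℕ
  | .setArr _ i j e => Polynomial.C (i.cost + j.cost + e.cost + 1)
  | .seq p q => p.bound + q.bound
  | .when e p => Polynomial.C (e.cost + 2) + p.bound
  | .loop _ p => Polynomial.X * (p.bound + Polynomial.C 8) + Polynomial.C 6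

theorem den_var {p : LoopProg} {x : ℕ} (hx : x ∉ p.vars) (m : Memory) :
    (p.den m).var x = m.var x := by
  induction p generalizing m with
  | setArr A i j e => rfl
  | seq p q hp hq =>
    simp only [vars, List.mem_append, not_or] at hx
    simp [den, hp hx.1, hq hx.2]
  | when e p hp =>
    simp only [den]
    split_ifs
    · exact hp hx m
    · rfl
  | loop y p hp =>
    simp only [vars, List.mem_cons, not_or] at hx
    have : ∀ j, (iter p.den y m j).var x = m.var x := by
      intro j
      induction j with
      | zero => simp [iter, Memory.setVar, hx.1]
      | succ j ih => simp [iter, Memory.setVar, hx.1, hp hx.2, ih]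
    exact this _

theorem den_arr {p : LoopProg} {A : ℕ} (hA : A ∉ p.arrs) (m : Memory) :
    (p.den m).arr A = m.arr A := by
  induction p generalizing m with
  | setArr B i j e =>
    simp only [arrs, List.mem_singleton] at hA
    simp [den, Memory.setArr, hA]
  | seq p q hp hq =>
    simp only [arrs, List.mem_append, not_or] at hA
    simp [den, hp hA.1, hq hA.2]
  | when e p hp =>
    simp only [den]
    split_ifs
    · exact hp hA m
    · rfl
  | loop y p hp =>
    have : ∀ j, (iter p.den y m j).arr A = m.arr A := by
      intro j
      induction j with
      | zero => rfl
      | succ j ih =>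
        change (p.den _).arr A = _
        rw [hp hA, ih]
    exact this _

theorem zero_notMem_vars {p : LoopProg} (h : p.wf = true) : 0 ∉ p.vars := by
  induction p with
  | setArr A i j e => simp [vars]
  | seq p q hp hq =>
    simp only [wf, Bool.and_eq_true] at h
    simp [vars, hp h.1, hq h.2]
  | when e p hp => exact hp h
  | loop y p hp =>
    simp only [wf, Bool.and_eq_true, decide_eq_true_eq] at h
    simp only [vars, List.mem_cons, not_or]
    exact ⟨fun e => h.1.1 e.symm, hp h.2⟩

theorem iter_self {f : Memory → Memory} {x : ℕ} (m : Memory) (j : ℕ) :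
    (iter f x m j).var x = j := by
  cases j <;> simp [iter, Memory.setVar]

theorem iter_var {p : LoopProg} {x y : ℕ} (hy : y ∉ (loop x p).vars) (m : Memory) (j : ℕ) :
    (iter p.den x m j).var y = m.var y := by
  simp only [vars, List.mem_cons, not_or] at hy
  induction j with
  | zero => simp [iter, Memory.setVar, hy.1]
  | succ j ih => simp [iter, Memory.setVar, hy.1, den_var hy.2, ih]

theorem iter_arr {p : LoopProg} {x A : ℕ} (hA : A ∉ p.arrs) (m : Memory) (j : ℕ) :
    (iter p.den x m j).arr A = m.arr A := by
  induction j with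
  | zero => rfl
  | succ j ih =>
    change (p.den _).arr A = _
    rw [den_arr hA, ih]

/-- A well-formed loop program halts in its denotation, within its time bound. -/
theorem exec {p : LoopProg} (h : p.wf = true) (m : Memory) :
    ∃ t, Exec p.toProg m (p.den m) t ∧ t ≤ p.bound.eval (m.var 0) := by
  induction p generalizing m with
  | setArr A i j e => exact ⟨_, .setArr m A i j e, by simp [bound]⟩
  | seq p q hp hq =>
    simp only [wf, Bool.and_eq_true] at h
    obtain ⟨s, hs, hs'⟩ := hp h.1 m
    obtain ⟨t, ht, ht'⟩ := hq h.2 (p.den m)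
    rw [den_var (zero_notMem_vars h.1)] at ht'
    refine ⟨s + t, .seq hs ht, ?_⟩
    simp only [bound, Polynomial.eval_add]
    omega
  | when e p hp =>
    by_cases he : e.eval m = 0
    · refine ⟨_, .condFalse (m' := (LoopProg.when e p).den m) he (t := 1) ?_, ?_⟩
      · simp only [den, he, ne_eq, not_true_eq_false, if_false]
        exact .skip m
      · simp only [bound, Polynomial.eval_add, Polynomial.eval_C]
        omega
    · obtain ⟨t, ht, ht'⟩ := hp h m
      refine ⟨_, .condTrue (m' := (LoopProg.when e p).den m) he (t := t) ?_, ?_⟩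
      · simp only [den, he, ne_eq, not_false_eq_true, if_true]
        exact ht
      · simp only [bound, Polynomial.eval_add, Polynomial.eval_C]
        omega
  | loop x p hp =>
    have h0 := zero_notMem_vars h
    simp only [wf, Bool.and_eq_true, decide_eq_true_eq] at h
    obtain ⟨⟨hx0, hxp⟩, hwf⟩ := h
    -- `d` counts the remaining rounds. A round costs 8 besides its body: 3 for the test, 4 for the
    -- increment, 1 for the loop step. The final test costs 4, and the initialization of `x` adds 2.
    have key : ∀ d j, j + d = m.var 0 → ∃ t,
        Exec (.loop (.sub (.var 0) (.var x))
          (.seq p.toProg (.setVar x (.add (.var x) (.lit 1))))) (iter p.den x m j)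
          (iter p.den x m (m.var 0)) t ∧ t ≤ d * (p.bound.eval (m.var 0) + 8) + 4 := by
      intro d
      induction d with
      | zero =>
        intro j hj
        obtain rfl : j = m.var 0 := by omega
        refine ⟨_, .loopEnd ?_, ?_⟩
        · simp [Expr.eval, iter_self, iter_var h0]
        · simp [Expr.cost]
      | succ d ih =>
        intro j hj
        obtain ⟨t, ht, ht'⟩ := ih (j + 1) (by omega)
        obtain ⟨s, hs, hs'⟩ := hp hwf (iter p.den x m j)
        rw [iter_var h0] at hs'
        have hset := Exec.setVar (p.den (iter p.den x m j)) x (.add (.var x) (.lit 1))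
        have hval : (Expr.add (.var x) (.lit 1)).eval (p.den (iter p.den x m j)) = j + 1 := by
          simp [Expr.eval, den_var hxp, iter_self]
        rw [hval] at hset
        refine ⟨_, .loopStep ?_ (.seq hs hset) ht, ?_⟩
        · simp only [Expr.eval, iter_self, iter_var h0]
          omega
        · simp only [Expr.cost, Nat.add_mul]
          omega
    obtain ⟨t, ht, ht'⟩ := key (m.var 0) 0 (by omega)
    refine ⟨_, .seq (.setVar m x (.lit 0)) ht, ?_⟩
    simp only [bound, Polynomial.eval_add, Polynomial.eval_C, Polynomial.eval_mul,
      Polynomial.eval_X, Expr.cost]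
    omega

/-- Needed to pass from a bound in the number of nodes to one in the instance size. -/
theorem bound_mono (p : LoopProg) : Monotone fun n => p.bound.eval n := by
  intro a b hab
  induction p with
  | setArr A i j e => simp [bound]
  | seq p q hp hq =>
    simp only [bound, Polynomial.eval_add] at *
    omega
  | when e p hp =>
    simp only [bound, Polynomial.eval_add, Polynomial.eval_C] at *
    omega
  | loop x p hp =>
    simp only [bound, Polynomial.eval_add, Polynomial.eval_C, Polynomial.eval_mul,
      Polynomial.eval_X] at *
    gcongr

/-- `Frame p m s`: the memories `m` and `s` differ only in places that `p` may write. -/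
structure Frame (p : LoopProg) (m s : Memory) : Prop where
  var : ∀ x, x ∉ p.vars → s.var x = m.var x
  arr : ∀ A, A ∉ p.arrs → s.arr A = m.arr A

/-- Induction along the rounds of a loop. -/
theorem loop_rule {x A : ℕ} {p : LoopProg} {m : Memory}
    {I : ℕ → (ℕ → ℕ → ℕ) → Prop} (h0 : I 0 (m.arr A))
    (hs : ∀ j < m.var 0, ∀ s, s.var x = j → Frame (loop x p) m s → I j (s.arr A) →
      I (j + 1) ((p.den s).arr A)) :
    I (m.var 0) (((loop x p).den m).arr A) := by
  have : ∀ j ≤ m.var 0, I j ((iter p.den x m j).arr A) := by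
    intro j hj
    induction j with
    | zero => exact h0
    | succ j ih =>
      exact hs j hj _ (iter_self m j)
        ⟨fun y hy => iter_var hy m j, fun B hB => iter_arr (p := p) hB m j⟩ (ih (by omega))
  exact this _ le_rfl

/-! ### Invariants for nested loops -/

/-- Nested loops. -/
def nest (xs : List ℕ) (p : LoopProg) : LoopProg := xs.foldr loop p

theorem nest_cons (x : ℕ) (xs : List ℕ) (p : LoopProg) : nest (x :: xs) p = loop x (nest xs p) :=
  rfl

theorem nest_vars (xs : List ℕ) (p : LoopProg) : (nest xs p).vars = xs ++ p.vars := by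
  induction xs with
  | nil => rfl
  | cons x xs ih => simp [nest_cons, vars, ih]

theorem Frame.refl (p : LoopProg) (m : Memory) : Frame p m m := ⟨fun _ _ => rfl, fun _ _ => rfl⟩

theorem Frame.of_cons {x : ℕ} {xs : List ℕ} {p : LoopProg} {m s s' : Memory}
    (h : Frame (loop x (nest xs p)) m s) (h' : Frame (nest xs p) s s') :
    Frame (nest (x :: xs) p) m s' :=
  ⟨fun y hy => by rw [h'.var y fun hy' => hy (List.mem_cons_of_mem _ hy'), h.var y hy],
    fun B hB => by rw [h'.arr B hB, h.arr B hB]⟩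

/-- Well-formedness keeps the inner loops from touching the outer variable, so the outer value `j`
can be merged with the inner indices `σ` into one index function. -/
theorem index_cons {n x : ℕ} {xs : List ℕ} {p : LoopProg} {s s' : Memory} {j : Fin n}
    {σ : ℕ → Fin n} (hwf : (nest (x :: xs) p).wf = true) (hs : s.var x = j)
    (h : Frame (nest xs p) s s') (hσ : ∀ y ∈ xs, s'.var y = σ y) :
    ∀ y ∈ x :: xs, s'.var y = (Function.update σ x j) y := by
  simp only [nest_cons, wf, Bool.and_eq_true, decide_eq_true_eq] at hwf
  obtain ⟨⟨hx0, hxp⟩, hwf⟩ := hwf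
  intro y hy
  rcases List.mem_cons.1 hy with rfl | hy
  · rw [h.var _ hxp, hs, Function.update_self]
  · rw [Function.update_of_ne (fun e => hxp (by simp [nest_vars, ← e, hy])), hσ y hy]

/-- In nested loops, a property of an array is preserved if all runs of the body preserve it. -/
theorem nest_inv {A n : ℕ} {p : LoopProg} {J : (ℕ → ℕ → ℕ) → Prop} (xs : List ℕ) (m : Memory)
    (hwf : (nest xs p).wf = true) (hn : m.var 0 = n)
    (hJ : ∀ s (σ : ℕ → Fin n), Frame (nest xs p) m s → (∀ x ∈ xs, s.var x = σ x) →
      J (s.arr A) → J ((p.den s).arr A)) (τ : ℕ → Fin n) (h : J (m.arr A)) :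
    J (((nest xs p).den m).arr A) := by
  induction xs generalizing m with
  -- Without loop variables the index function is arbitrary; `τ` supplies one, since `Fin n` may be
  -- empty.
  | nil => exact hJ m τ (Frame.refl _ m) (by simp) h
  | cons x xs ih =>
    have hwf' : (nest xs p).wf = true := by
      simp only [nest_cons, wf, Bool.and_eq_true] at hwf
      exact hwf.2
    refine loop_rule (A := A) (m := m) (I := fun _ a => J a) h ?_
    intro j hj s hsj hfs hJs
    refine ih s hwf' (by rw [hfs.var 0 (zero_notMem_vars hwf), hn]) ?_ hJs
    intro s' σ h1 h2
    exact hJ s' _ (hfs.of_cons h1) (index_cons (j := ⟨j, hn ▸ hj⟩) hwf hsj h1 h2)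

/-- In nested loops, a property of an array holds in the end if it is preserved by all runs of the
body, and established by the run with the indices `τ`. -/
theorem nest_hit {A n : ℕ} {p : LoopProg} {J Q : (ℕ → ℕ → ℕ) → Prop} (xs : List ℕ) (m : Memory)
    (hwf : (nest xs p).wf = true) (hn : m.var 0 = n)
    (hJ : ∀ s (σ : ℕ → Fin n), Frame (nest xs p) m s → (∀ x ∈ xs, s.var x = σ x) →
      J (s.arr A) → J ((p.den s).arr A))
    (hQ : ∀ s (σ : ℕ → Fin n), Frame (nest xs p) m s → (∀ x ∈ xs, s.var x = σ x) →
      J (s.arr A) → Q (s.arr A) → Q ((p.den s).arr A))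
    (τ : ℕ → Fin n)
    (hit : ∀ s, Frame (nest xs p) m s → (∀ x ∈ xs, s.var x = τ x) →
      J (s.arr A) → Q ((p.den s).arr A)) (h : J (m.arr A)) :
    Q (((nest xs p).den m).arr A) := by
  induction xs generalizing m with
  | nil => exact hit m (Frame.refl _ m) (by simp) h
  | cons x xs ih =>
    have hwf' : (nest xs p).wf = true := by
      simp only [nest_cons, wf, Bool.and_eq_true] at hwf
      exact hwf.2
    -- The invariant demands `Q` as soon as the counter has passed the value `τ x`.
    have main := loop_rule (A := A) (m := m)
      (I := fun j a => J a ∧ ((τ x : ℕ) < j → Q a)) ⟨h, by simp⟩ (by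
        intro j hj s hsj hfs ⟨hJs, hQs⟩
        rw [hn] at hj
        have n0 : s.var 0 = n := by rw [hfs.var 0 (zero_notMem_vars hwf), hn]
        have hJ' : ∀ s' (σ : ℕ → Fin n), Frame (nest xs p) s s' → (∀ y ∈ xs, s'.var y = σ y) →
            J (s'.arr A) → J ((p.den s').arr A) := fun s' σ h1 h2 =>
          hJ s' _ (hfs.of_cons h1) (index_cons (j := ⟨j, hj⟩) hwf hsj h1 h2)
        have hQ' : ∀ s' (σ : ℕ → Fin n), Frame (nest xs p) s s' → (∀ y ∈ xs, s'.var y = σ y) →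
            J (s'.arr A) → Q (s'.arr A) → Q ((p.den s').arr A) := fun s' σ h1 h2 =>
          hQ s' _ (hfs.of_cons h1) (index_cons (j := ⟨j, hj⟩) hwf hsj h1 h2)
        refine ⟨nest_inv xs s hwf' n0 hJ' τ hJs, fun hlt => ?_⟩
        by_cases hjt : j = τ x
        · refine ih s hwf' n0 hJ' hQ' (fun s' h1 h2 => hit s' (hfs.of_cons h1) ?_) hJs
          have := index_cons (j := τ x) hwf (hsj.trans hjt) h1 h2
          rwa [Function.update_eq_self] at this
        · exact (nest_inv (J := fun a => J a ∧ Q a) xs s hwf' n0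
            (fun s' σ h1 h2 h3 => ⟨hJ' s' σ h1 h2 h3.1, hQ' s' σ h1 h2 h3.1 h3.2⟩) τ
            ⟨hJs, hQs (by omega)⟩).2)
    exact main.2 (by rw [hn]; exact (τ x).2)

end LoopProg

/-! ### Blocks -/

section Blocks

variable {V C : Type*} {G : SimpleGraph V} {col : V → C} {v₀ : V}

/-- Two nodes belong to the same block if they are equal, or connected by a monochromatic path
that avoids `v₀`. -/
def Block (G : SimpleGraph V) (col : V → C) (v₀ : V) : V → V → Prop :=
  Relation.TransGen fun x y => x = y ∨ (G.Adj x y ∧ col x = col y ∧ x ≠ v₀ ∧ y ≠ v₀)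

/-- Two nodes touch if their blocks are equal or adjacent. -/
def Touch (G : SimpleGraph V) (col : V → C) (v₀ : V) (x y : V) : Prop :=
  ∃ x' y', Block G col v₀ x x' ∧ (x' = y' ∨ G.Adj x' y') ∧ Block G col v₀ y' y

theorem Block.refl (x : V) : Block G col v₀ x x := .single (.inl rfl)

theorem Block.symm {x y : V} (h : Block G col v₀ x y) : Block G col v₀ y x := by
  unfold Block at h ⊢
  rw [← Relation.transGen_swap] at h
  refine Relation.TransGen.mono (fun a b hab => ?_) _ _ h
  rcases hab with h | ⟨h1, h2, h3, h4⟩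
  · exact .inl h.symm
  · exact .inr ⟨h1.symm, h2.symm, h4, h3⟩

theorem Block.trans {x y z : V} (h : Block G col v₀ x y) (h' : Block G col v₀ y z) :
    Block G col v₀ x z := Relation.TransGen.trans h h'

/-- Blocks are monochromatic, and `v₀` is alone in its block whatever its color, as it is the only
node owned at the start. -/
theorem Block.eq_or {x y : V} (h : Block G col v₀ x y) :
    x = y ∨ (col x = col y ∧ x ≠ v₀ ∧ y ≠ v₀) := by
  induction h with
  | single h =>
    rcases h with h | ⟨-, h⟩
    · exact .inl h
    · exact .inr h
  | tail _ h ih =>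
    rcases h with rfl | ⟨-, h1, h2, h3⟩
    · exact ih
    · rcases ih with rfl | ⟨h4, h5, h6⟩
      · exact .inr ⟨h1, h2, h3⟩
      · exact .inr ⟨h4.trans h1, h5, h3⟩

theorem Block.ne {x y : V} (h : Block G col v₀ x y) (hx : x ≠ v₀) :
    y ≠ v₀ ∧ col y = col x := by
  rcases h.eq_or with rfl | h
  · exact ⟨hx, rfl⟩
  · exact ⟨h.2.2, h.1.symm⟩

theorem Touch.refl (x : V) : Touch G col v₀ x x := ⟨x, x, .refl x, .inl rfl, .refl x⟩

theorem Touch.symm {x y : V} : Touch G col v₀ x y → Touch G col v₀ y x := by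
  rintro ⟨x', y', h1, h2, h3⟩
  exact ⟨y', x', h3.symm, h2.imp Eq.symm fun h => h.symm, h1.symm⟩

theorem Touch.of_block_left {x y z : V} (h : Block G col v₀ x y) :
    Touch G col v₀ x z → Touch G col v₀ y z := by
  rintro ⟨x', y', h1, h2, h3⟩
  exact ⟨x', y', h.symm.trans h1, h2, h3⟩

theorem Touch.of_block_right {x y z : V} (h : Block G col v₀ y z) :
    Touch G col v₀ x y → Touch G col v₀ x z := fun hx => (hx.symm.of_block_left h).symm

/-- Touching nodes of the same color belong to the same block. -/
theorem Touch.block {x y : V} (h : Touch G col v₀ x y) (hx : x ≠ v₀) (hy : y ≠ v₀)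
    (hc : col x = col y) : Block G col v₀ x y := by
  obtain ⟨x', y', h1, h2, h3⟩ := h
  refine h1.trans (Block.trans (.single ?_) h3)
  rcases h2 with h2 | h2
  · exact .inl h2
  · obtain ⟨h4, h5⟩ := h1.ne hx
    obtain ⟨h6, h7⟩ := h3.symm.ne hy
    exact .inr ⟨h2, by rw [h5, hc, h7], h4, h6⟩

/-- In a co-comparability graph, blocks that do not touch are comparable. -/
theorem exists_blockOrder (h : IsCocomparability G) (col : V → C) (v₀ : V) :
    ∃ lt : V → V → Prop, (∀ x y z, lt x y → lt y z → lt x z) ∧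
      ∀ x y, Touch G col v₀ x y ↔ ¬ lt x y ∧ ¬ lt y x := by
  obtain ⟨P, hP⟩ := h
  refine ⟨fun x y => ∀ x' y', Block G col v₀ x x' → Block G col v₀ y y' → P.lt x' y', ?_, ?_⟩
  · intro x y z hxy hyz x' z' hx hz
    exact @lt_trans V P.toPreorder _ _ _ (hxy x' y hx (.refl y)) (hyz y z' (.refl y) hz)
  · intro x y
    constructor
    · rintro ⟨x', y', h1, h2, h3⟩
      have : ¬ P.lt x' y' ∧ ¬ P.lt y' x' := by
        rcases h2 with rfl | h2
        · exact ⟨@lt_irrefl V P.toPreorder _, @lt_irrefl V P.toPreorder _⟩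
        · exact ((hP _ _).1 h2).2
      exact ⟨fun h => this.1 (h _ _ h1 h3.symm), fun h => this.2 (h _ _ h3.symm h1)⟩
    · intro hn
      by_contra ht
      have hc : ∀ a b, Block G col v₀ x a → Block G col v₀ y b → P.lt a b ∨ P.lt b a := by
        intro a b ha hb
        by_contra hab
        push Not at hab
        refine ht ⟨a, b, ha, ?_, hb.symm⟩
        by_cases e : a = b
        · exact .inl e
        · exact .inr ((hP a b).2 ⟨e, hab⟩)
      -- Adjacent nodes are incomparable, so no `c` lies between them. Hence walking through a block
      -- never changes the side of a node comparable to all of it.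
      have hstep : ∀ {a b c}, a = b ∨ (G.Adj a b ∧ col a = col b ∧ a ≠ v₀ ∧ b ≠ v₀) →
          (P.lt a c → P.lt c b → False) ∧ (P.lt c a → P.lt b c → False) := by
        intro a b c hab
        have hab' : ¬ P.lt a b ∧ ¬ P.lt b a := by
          rcases hab with rfl | hab
          · exact ⟨@lt_irrefl V P.toPreorder _, @lt_irrefl V P.toPreorder _⟩
          · exact ((hP _ _).1 hab.1).2
        exact ⟨fun h1 h2 => hab'.1 (@lt_trans V P.toPreorder _ _ _ h1 h2),
          fun h1 h2 => hab'.2 (@lt_trans V P.toPreorder _ _ _ h2 h1)⟩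
      have hl : ∀ a b c, Block G col v₀ a b → (∀ b, Block G col v₀ a b → P.lt b c ∨ P.lt c b) →
          (P.lt a c → P.lt b c) ∧ (P.lt c a → P.lt c b) := by
        intro a b c hb hall
        induction hb with
        | single hs =>
          have := hall _ (.single hs)
          have := hstep (c := c) hs
          tauto
        | tail hb' hs ih =>
          have h1 := hall _ hb'
          have h2 := hall _ (hb'.tail hs)
          have := hstep (c := c) hs
          tauto
      have key : ∀ a b, Block G col v₀ x a → Block G col v₀ y b →
          (P.lt x y → P.lt a b) ∧ (P.lt y x → P.lt b a) := by
        intro a b ha hb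
        have h1 := hl x a y ha fun c hc' => hc c y hc' (.refl y)
        have h2 := hl y b a hb fun c hc' => (hc a c ha hc').symm
        tauto
      rcases hc x y (.refl x) (.refl y) with h | h
      · exact hn.1 fun a b ha hb => (key a b ha hb).1 h
      · exact hn.2 fun b a hb ha => (key a b ha hb).2 h

end Blocks

/-! ### The game on touching blocks -/

section Game

variable {V C : Type*} {T : V → V → Prop} {col : V → C} {v₀ : V}

/-- The territory `W` after calling the color `c`, in terms of the relation `T` of touching. -/
def call (T : V → V → Prop) (col : V → C) (v₀ : V) (W : Set V) (c : C) : Set V :=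
  W ∪ {x | x ≠ v₀ ∧ col x = c ∧ ∃ w ∈ W, T w x}

/-- Along a path of color `c`, each node is `v₀`, is touched directly from `W`, or lies in the block
of its predecessor. Conversely, a touched block of color `c` is entered at one node and traversed
from there. -/
theorem union_setNbhd_eq_call {G : SimpleGraph V} {W : Set V} (h₀ : v₀ ∈ W)
    (hW : ∀ x y, Block G col v₀ x y → x ∈ W → y ∈ W) (c : C) :
    W ∪ setNbhd G col W c = call (Touch G col v₀) col v₀ W c := by
  ext x
  constructor
  · rintro (hx | hx)
    · exact .inl hx
    · simp only [setNbhd, nodeNbhd, Set.mem_iUnion, Set.mem_ofPred_eq] at hx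
      obtain ⟨w, hw, hx⟩ := hx
      have aux : ∀ y z, y ∈ call (Touch G col v₀) col v₀ W c → G.Adj y z → col z = c →
          z ∈ call (Touch G col v₀) col v₀ W c := by
        intro y z hy hyz hz
        by_cases hz0 : z = v₀
        · exact .inl (hz0 ▸ h₀)
        · rcases hy with hy | ⟨hy0, hyc, w', hw', ht⟩
          · exact .inr ⟨hz0, hz, y, hy, y, z, .refl y, .inr hyz, .refl z⟩
          · exact .inr ⟨hz0, hz, w', hw',
              ht.of_block_right (.single (.inr ⟨hyz, hyc.trans hz.symm, hy0, hz0⟩))⟩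
      induction hx with
      | single h => exact aux _ _ (.inl hw) h.1 h.2
      | tail _ h ih => exact aux _ _ ih h.1 h.2
  · rintro (hx | ⟨hx0, hxc, w, hw, w', x', h1, h2, h3⟩)
    · exact .inl hx
    · have hw' := hW _ _ h1 hw
      obtain ⟨hx0', hxc'⟩ := h3.symm.ne hx0
      rcases h2 with rfl | h2
      · exact .inl (hW _ _ h3 hw')
      · right
        simp only [setNbhd, nodeNbhd, Set.mem_iUnion, Set.mem_ofPred_eq]
        refine ⟨w', hw', ?_⟩
        have h2 : Relation.TransGen (fun x y => G.Adj x y ∧ col y = c) w' x' :=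
          .single ⟨h2, hxc'.trans hxc⟩
        replace hxc' := hxc'.trans hxc
        clear hx0 hxc
        induction h3 with
        | single h =>
          rcases h with rfl | h
          · exact h2
          · exact h2.tail ⟨h.1, h.2.1 ▸ hxc'⟩
        | @tail a b hb h ih =>
          rcases h with rfl | h
          · exact ih
          · obtain ⟨-, hc⟩ := Block.ne hb hx0'
            exact ih.tail ⟨h.1, h.2.1 ▸ hc ▸ hxc'⟩

theorem conquered_eq {G : SimpleGraph V} (γ : List C) {W : Set V} (h₀ : v₀ ∈ W)
    (hW : ∀ x y, Block G col v₀ x y → x ∈ W → y ∈ W) :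
    conquered G col W γ = γ.foldl (call (Touch G col v₀) col v₀) W := by
  induction γ generalizing W with
  | nil => rfl
  | cons c γ ih =>
    simp only [conquered, List.foldl_cons] at ih ⊢
    rw [union_setNbhd_eq_call h₀ hW]
    refine ih (.inl h₀) ?_
    rintro x y hxy (hx | ⟨hx0, hxc, w, hw, ht⟩)
    · exact .inl (hW x y hxy hx)
    · obtain ⟨hy0, hyc⟩ := hxy.ne hx0
      exact .inr ⟨hy0, hyc.trans hxc, w, hw, ht.of_block_right hxy⟩

theorem conquered_start (G : SimpleGraph V) (col : V → C) (v₀ : V) (γ : List C) :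
    conquered G col {v₀} γ = γ.foldl (call (Touch G col v₀) col v₀) {v₀} := by
  refine conquered_eq γ rfl ?_
  rintro x y hxy rfl
  rcases hxy.eq_or with rfl | h
  · rfl
  · exact absurd rfl h.2.1

/-- `a` and `b` are connected by a path of nodes that do not touch `x`. -/
def Avoid (T : V → V → Prop) (x : V) : V → V → Prop :=
  Relation.TransGen fun a b => T a b ∧ ¬ T x a ∧ ¬ T x b

/-- One end of the territory moves from `u` to `u'` when the color `c` is called. -/
def Move (T : V → V → Prop) (col : V → C) (v₀ : V) (c : C) (u u' : V) : Prop :=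
  u' = u ∨ (T u u' ∧ u' ≠ v₀ ∧ col u' = c)

open Classical in
/-- A call of color `c` is free of charge if every connected territory that contains `u` and `d`
touches all nodes of color `c`. -/
noncomputable def moveCost (T : V → V → Prop) (col : V → C) (v₀ : V) (c : C) (u d : V) : ℕ :=
  if ∃ x, x ≠ v₀ ∧ col x = c ∧ Avoid T x u d then 1 else 0

/-- `MoveSeq r N u d`: a sequence of `r` moves of total cost `N` leads from `(v₀, v₀)`
to `(u, d)`. -/
inductive MoveSeq (T : V → V → Prop) (col : V → C) (v₀ : V) : ℕ → ℕ → V → V → Prop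
  | nil : MoveSeq T col v₀ 0 0 v₀ v₀
  | step {r N : ℕ} {u d u' d' y : V} : MoveSeq T col v₀ r N u d → y ≠ v₀ →
      Move T col v₀ (col y) u u' → Move T col v₀ (col y) d d' →
      MoveSeq T col v₀ (r + 1) (N + moveCost T col v₀ (col y) u d) u' d'

theorem moveCost_le_one (c : C) (u d : V) : moveCost T col v₀ c u d ≤ 1 := by
  unfold moveCost; split_ifs <;> simp

/-- Every connected territory that contains `u` and `d` touches all nodes. -/
def IsGoal (T : V → V → Prop) (u d : V) : Prop := ∀ x, ¬ Avoid T x u d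

theorem subset_call (W : Set V) (c : C) : W ⊆ call T col v₀ W c := Set.subset_union_left

theorem call_mono {W W' : Set V} (h : W ⊆ W') (c : C) :
    call T col v₀ W c ⊆ call T col v₀ W' c := by
  rintro x (hx | ⟨h0, h1, w, hw, ht⟩)
  · exact .inl (h hx)
  · exact .inr ⟨h0, h1, w, h hw, ht⟩

theorem subset_foldl_call (γ : List C) (W : Set V) : W ⊆ γ.foldl (call T col v₀) W := by
  induction γ generalizing W with
  | nil => exact subset_rfl
  | cons c γ ih => exact (subset_call W c).trans (ih _)

theorem call_subset_foldl {γ : List C} {c : C} (hc : c ∈ γ) (W : Set V) :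
    call T col v₀ W c ⊆ γ.foldl (call T col v₀) W := by
  induction γ generalizing W with
  | nil => simp at hc
  | cons a γ ih =>
    rcases List.mem_cons.1 hc with rfl | hc
    · exact subset_foldl_call γ _
    · exact (call_mono (subset_call W a) c).trans (ih hc _)

/-- The territory `W` is connected. -/
def Conn (T : V → V → Prop) (W : Set V) : Prop :=
  ∀ a ∈ W, ∀ b ∈ W, Relation.TransGen (fun a b => T a b ∧ a ∈ W ∧ b ∈ W) a b

theorem Conn.call {W : Set V} (hr : ∀ x, T x x) (hs : ∀ x y, T x y → T y x) (h : Conn T W)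
    (c : C) : Conn T (call T col v₀ W c) := by
  have key : ∀ a ∈ HoneyBee.call T col v₀ W c, ∃ w ∈ W, T w a := by
    rintro a (ha | ⟨-, -, h⟩)
    · exact ⟨a, ha, hr a⟩
    · exact h
  intro a ha b hb
  obtain ⟨w, hw, hwa⟩ := key a ha
  obtain ⟨w', hw', hwb⟩ := key b hb
  refine .head ⟨hs _ _ hwa, ha, .inl hw⟩ (.tail ?_ ⟨hwb, .inl hw', hb⟩)
  exact Relation.TransGen.mono (fun x y h => ⟨h.1, .inl h.2.1, .inl h.2.2⟩) _ _ (h w hw w' hw')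

/-- If nothing in `W` touched `x`, a path inside `W` from `u` to `d` would avoid `x`. -/
theorem Conn.exists_touch {W : Set V} (hs : ∀ x y, T x y → T y x) (h : Conn T W) {u d x : V}
    (hu : u ∈ W) (hd : d ∈ W) (hx : ¬ Avoid T x u d) : ∃ w ∈ W, T w x := by
  by_contra hn
  push Not at hn
  exact hx (Relation.TransGen.mono (fun a b hab =>
    ⟨hab.1, fun ht => hn a hab.2.1 (hs _ _ ht), fun ht => hn b hab.2.2 (hs _ _ ht)⟩) _ _
    (h u hu d hd))

/-- Nodes of one block have the same touching neighbors. This lemma transfers order relations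
between such twins for an abstract order of which only transitivity and its link to touching are
known. -/
theorem lt_of_twin {lt : V → V → Prop} (htr : ∀ x y z, lt x y → lt y z → lt x z)
    (hT : ∀ x y, T x y ↔ ¬ lt x y ∧ ¬ lt y x) {x y z : V} (hxy : T x y)
    (h : ∀ z, T y z → T x z) (hx : lt x z) : lt y z := by
  by_contra hyz
  by_cases hzy : lt z y
  · exact ((hT x y).1 hxy).1 (htr _ _ _ hx hzy)
  · exact ((hT x z).1 (h z ((hT y z).2 ⟨hyz, hzy⟩))).1 hx

/-- Every node of an avoiding path is comparable to `x`, and consecutive nodes touch, so they cannot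
lie on different sides of `x`. -/
theorem Avoid.lt_or_lt {lt : V → V → Prop} (hr : ∀ x, T x x)
    (htr : ∀ x y z, lt x y → lt y z → lt x z)
    (hT : ∀ x y, T x y ↔ ¬ lt x y ∧ ¬ lt y x) {x u d : V} (h : Avoid T x u d) :
    (lt u x ∧ lt d x) ∨ (lt x u ∧ lt x d) := by
  have aux : ∀ {a b}, T a b ∧ ¬ T x a ∧ ¬ T x b → (lt a x ∧ lt b x) ∨ (lt x a ∧ lt x b) := by
    rintro a b ⟨h1, h2, h3⟩
    rw [hT] at h1 h2 h3
    have h4 := htr a x b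
    have h5 := htr b x a
    tauto
  induction h with
  | single h => exact aux h
  | @tail b c _ h ih =>
    have h1 := aux h
    have h2 : ¬ (lt b x ∧ lt x b) := fun h2 => by
      exact ((hT b b).1 (hr b)).1 (htr _ _ _ h2.1 h2.2)
    tauto

/-- `u` dominates `v` if all nodes above `u` are above `v`. -/
def Dominates (lt : V → V → Prop) (u v : V) : Prop := ∀ x, lt u x → lt v x

/-- Suppose `v` was gained by touching `w`. An end `u` dominating `w` cannot be below `v`; it either
touches `v` and moves there, or is already above `v` and stays. The form with `w` chosen before `u`
suits the induction over calls. -/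
theorem exists_move {lt : V → V → Prop} (htr : ∀ x y z, lt x y → lt y z → lt x z)
    (hT : ∀ x y, T x y ↔ ¬ lt x y ∧ ¬ lt y x) {W : Set V} {c : C} {v : V}
    (hv : v ∈ call T col v₀ W c) : ∃ w ∈ W, ∀ u, Dominates lt u w →
      ∃ u', Move T col v₀ c u u' ∧ Dominates lt u' v := by
  rcases hv with hv | ⟨hv0, hvc, w, hw, ht⟩
  · exact ⟨v, hv, fun u hu => ⟨u, .inl rfl, hu⟩⟩
  · refine ⟨w, hw, fun u hu => ?_⟩
    by_cases hT' : T u v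
    · exact ⟨v, .inr ⟨hT', hv0, hvc⟩, fun x hx => hx⟩
    · have h1 : ¬ lt u v := fun h => ((hT w v).1 ht).1 (hu v h)
      have h2 : lt v u := by
        by_contra h2
        exact hT' ((hT u v).2 ⟨h1, h2⟩)
      exact ⟨u, .inl rfl, fun x hx => htr _ _ _ h2 hx⟩

/-! ### Completed colors, and the translation between calls and moves -/

variable [Fintype V]

open Classical in
/-- The colors of the nodes other than `v₀`. -/
noncomputable def colors (col : V → C) (v₀ : V) : Finset C :=
  (Finset.univ.filter (· ≠ v₀)).image col

open Classical in
/-- The colors all of whose nodes belong to the territory `W`. -/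
noncomputable def complete (col : V → C) (v₀ : V) (W : Set V) : Finset C :=
  (colors col v₀).filter fun c => ∀ x, x ≠ v₀ → col x = c → x ∈ W

theorem mem_colors {c : C} : c ∈ colors col v₀ ↔ ∃ x, x ≠ v₀ ∧ col x = c := by
  simp [colors]

theorem mem_complete {c : C} {W : Set V} :
    c ∈ complete col v₀ W ↔ c ∈ colors col v₀ ∧ ∀ x, x ≠ v₀ → col x = c → x ∈ W := by
  simp [complete]

theorem complete_mono {W W' : Set V} (h : W ⊆ W') :
    complete col v₀ W ⊆ complete col v₀ W' := fun c hc => by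
  rw [mem_complete] at hc ⊢
  exact ⟨hc.1, fun x h0 h1 => h (hc.2 x h0 h1)⟩

theorem mem_complete_of_call {W : Set V} {a c : C} (hac : a ≠ c)
    (ha : a ∈ complete col v₀ (call T col v₀ W c)) : a ∈ complete col v₀ W := by
  rw [mem_complete] at ha ⊢
  refine ⟨ha.1, fun x h0 h1 => ?_⟩
  rcases ha.2 x h0 h1 with h | ⟨-, h, -⟩
  · exact h
  · exact absurd (h1.symm.trans h) hac

/-- Every move sequence is followed by some color sequence, with one additional call for each color
that has been completed. -/
theorem exists_calls_of_moveSeq (hr : ∀ x, T x x) (hs : ∀ x y, T x y → T y x) {r N : ℕ} {u d : V}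
    (h : MoveSeq T col v₀ r N u d) : ∃ (γ : List C) (W : Set V),
      γ.foldl (call T col v₀) {v₀} = W ∧ Conn T W ∧ u ∈ W ∧ d ∈ W ∧
      γ.length ≤ N + (complete col v₀ W).card := by
  induction h with
  | nil =>
    refine ⟨[], {v₀}, rfl, ?_, rfl, rfl, by simp⟩
    rintro a rfl b rfl
    exact .single ⟨hr _, rfl, rfl⟩
  | @step r N u d u' d' y _ hy hu hd ih =>
    obtain ⟨γ, W, rfl, hC, huW, hdW, hlen⟩ := ih
    set W := γ.foldl (call T col v₀) {v₀} with hWdef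
    have hcy : col y ∈ colors col v₀ := mem_colors.2 ⟨y, hy, rfl⟩
    -- If the color is already complete, the move stays within the territory and no call is made.
    by_cases hc : col y ∈ complete col v₀ W
    · have hm : ∀ {a b}, a ∈ W → Move T col v₀ (col y) a b → b ∈ W := by
        rintro a b ha (rfl | ⟨-, h0, h1⟩)
        · exact ha
        · exact (mem_complete.1 hc).2 b h0 h1
      exact ⟨γ, W, rfl, hC, hm huW hu, hm hdW hd, by omega⟩
    · have hm : ∀ {a b}, a ∈ W → Move T col v₀ (col y) a b → b ∈ call T col v₀ W (col y) := by
        rintro a b ha (rfl | ⟨ht, h0, h1⟩)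
        · exact .inl ha
        · exact .inr ⟨h0, h1, a, ha, ht⟩
      refine ⟨γ ++ [col y], call T col v₀ W (col y), by simp [hWdef], hC.call hr hs _,
        hm huW hu, hm hdW hd, ?_⟩
      have hle := Finset.card_le_card
        (complete_mono (col := col) (v₀ := v₀)
          (subset_call (T := T) (col := col) (v₀ := v₀) W (col y)))
      simp only [List.length_append, List.length_singleton]
      by_cases hB : ∃ x, x ≠ v₀ ∧ col x = col y ∧ Avoid T x u d
      · simp only [moveCost, hB, if_true]
        omega
      · simp only [moveCost, hB, if_false]
        -- A free move whose color was incomplete: its call is paid for by the newly completed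
        -- color.
        have : (complete col v₀ W).card < (complete col v₀ (call T col v₀ W (col y))).card := by
          refine Finset.card_lt_card ((Finset.ssubset_iff_of_subset
            (complete_mono (subset_call W (col y)))).2 ⟨col y, mem_complete.2 ⟨hcy, ?_⟩, hc⟩)
          intro x h0 h1
          exact .inr ⟨h0, h1, hC.exists_touch hs huW hdW fun hA => hB ⟨x, h0, h1, hA⟩⟩
        omega

/-- A move sequence to a goal yields a conquering color sequence. -/
theorem exists_conquering_of_moveSeq (hr : ∀ x, T x x) (hs : ∀ x y, T x y → T y x) {r N b : ℕ}
    {u d : V} (h : MoveSeq T col v₀ r N u d) (hg : IsGoal T u d)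
    (hb : N + (colors col v₀).card ≤ b) :
    ∃ γ : List C, γ.length = b ∧ γ.foldl (call T col v₀) {v₀} = Set.univ := by
  classical
  obtain ⟨γ, W, hγ, hC, hu, hd, hlen⟩ := exists_calls_of_moveSeq hr hs h
  -- At a goal the territory touches every node, so one call for each incomplete color finishes. The
  -- rest is padding to length exactly `b`.
  let δ := (colors col v₀ \ complete col v₀ W).toList
  have hsub : complete col v₀ W ⊆ colors col v₀ := Finset.filter_subset _ _
  have hδ : δ.length + (complete col v₀ W).card = (colors col v₀).card := by
    rw [Finset.length_toList]
    exact Finset.card_sdiff_add_card_eq_card hsub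
  refine ⟨γ ++ δ ++ List.replicate (b - (γ ++ δ).length) (col v₀), ?_, ?_⟩
  · simp only [List.length_append, List.length_replicate]
    omega
  · rw [List.foldl_append, List.foldl_append, hγ]
    refine Set.eq_univ_of_forall fun x => subset_foldl_call _ _ ?_
    obtain ⟨w, hw, ht⟩ := hC.exists_touch hs hu hd (hg x)
    by_cases hx : x = v₀
    · subst hx
      exact subset_foldl_call _ _ (hγ ▸ subset_foldl_call γ _ rfl)
    · by_cases hc : col x ∈ complete col v₀ W
      · exact subset_foldl_call _ _ ((mem_complete.1 hc).2 x hx rfl)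
      · refine call_subset_foldl (c := col x) ?_ W (.inr ⟨hx, rfl, w, hw, ht⟩)
        rw [Finset.mem_toList, Finset.mem_sdiff]
        exact ⟨mem_colors.2 ⟨x, hx, rfl⟩, hc⟩

section Order

variable {lt : V → V → Prop}

/-- For a completing call the end is steered towards an uppermost node `m` of color `c`. Since `m`
is conquered after the call, it touches some `w` in the old territory, so an end dominating `w` is
not below `m`, hence not below any node of color `c`. -/
theorem exists_move_of_complete (hr : ∀ x, T x x) (hs : ∀ x y, T x y → T y x)
    (htr : ∀ x y z, lt x y → lt y z → lt x z)
    (hT : ∀ x y, T x y ↔ ¬ lt x y ∧ ¬ lt y x)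
    (htw : ∀ x y, T x y → x ≠ v₀ → y ≠ v₀ → col x = col y → ∀ z, T x z → T y z)
    {W : Set V} {c : C} {v : V} (hv : v ∈ call T col v₀ W c)
    (hc : c ∈ complete col v₀ (call T col v₀ W c)) : ∃ w ∈ W, ∀ u, Dominates lt u w →
      (∀ x, x ≠ v₀ → col x = c → ¬ lt u x) ∧
      ∃ u', Move T col v₀ c u u' ∧ Dominates lt u' v := by
  rw [mem_complete] at hc
  by_cases hv' : ∃ x, x ≠ v₀ ∧ col x = c ∧ (lt v x ∨ v = x)
  · obtain ⟨x₀, hx0, hxc, hvx⟩ := hv'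
    have irr : ∀ x, ¬ lt x x := fun x => ((hT x x).1 (hr x)).1
    have wf : WellFounded (flip lt) := by
      have : IsTrans V (flip lt) := ⟨fun a b c h1 h2 => htr _ _ _ h2 h1⟩
      have : Std.Irrefl (flip lt) := ⟨irr⟩
      exact Finite.wellFounded_of_trans_of_irrefl _
    obtain ⟨m, ⟨hm0, hmc⟩, hmax⟩ := wf.has_min {x | x ≠ v₀ ∧ col x = c} ⟨x₀, hx0, hxc⟩
    have htwin : ∀ x, x ≠ v₀ → col x = c → lt x m ∨
        (T x m ∧ (∀ z, T x z → T m z) ∧ ∀ z, T m z → T x z) := by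
      intro x h0 h1
      by_cases h : lt x m
      · exact .inl h
      · have hxm : T x m := (hT x m).2 ⟨h, hmax x ⟨h0, h1⟩⟩
        exact .inr ⟨hxm, htw x m hxm h0 hm0 (h1.trans hmc.symm),
          htw m x (hs _ _ hxm) hm0 h0 (hmc.trans h1.symm)⟩
    have hlt : ∀ x z, x ≠ v₀ → col x = c → lt z x → lt z m := by
      intro x z h0 h1 hz
      rcases htwin x h0 h1 with h | ⟨h2, -, h3⟩
      · exact htr _ _ _ hz h
      · exact lt_of_twin (lt := flip lt) (fun a b c h1 h2 => htr _ _ _ h2 h1)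
          (fun a b => (hT a b).trans and_comm) h2 h3 hz
    have hmv : Dominates lt m v := by
      intro z hz
      rcases hvx with hvx | rfl
      · exact htr _ _ _ (hlt x₀ v hx0 hxc hvx) hz
      · rcases htwin v hx0 hxc with h | ⟨h1, h2, -⟩
        · exact htr _ _ _ h hz
        · exact lt_of_twin htr hT (hs _ _ h1) h2 hz
    obtain ⟨w, hw, hwm⟩ : ∃ w ∈ W, T w m := by
      rcases hc.2 m hm0 hmc with h | ⟨-, -, h⟩
      · exact ⟨m, h, hr m⟩
      · exact h
    refine ⟨w, hw, fun u hu => ?_⟩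
    have hum : ¬ lt u m := fun h => ((hT w m).1 hwm).1 (hu m h)
    refine ⟨fun x h0 h1 h => hum (hlt x u h0 h1 h), ?_⟩
    by_cases hT' : T u m
    · exact ⟨m, .inr ⟨hT', hm0, hmc⟩, hmv⟩
    · have h2 : lt m u := by
        by_contra h2
        exact hT' ((hT u m).2 ⟨hum, h2⟩)
      exact ⟨u, .inl rfl, fun x hx => hmv x (htr _ _ _ h2 hx)⟩
  -- Here no node of color `c` equals `v` or lies above it: `v` is old, and any end dominating it
  -- already has no such node above.
  · have hvW : v ∈ W := by
      rcases hv with hv | ⟨h0, h1, -⟩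
      · exact hv
      · exact absurd ⟨v, h0, h1, .inr rfl⟩ hv'
    exact ⟨v, hvW, fun u hu => ⟨fun x h0 h1 h => hv' ⟨x, h0, h1, .inl (hu x h)⟩,
      u, .inl rfl, hu⟩⟩

/-- Every color sequence is followed by move sequences that save one unit of cost for each
completed color, and reach beyond any two given conquered nodes. -/
theorem exists_moveSeq_of_calls (hr : ∀ x, T x x) (hs : ∀ x y, T x y → T y x)
    (htr : ∀ x y z, lt x y → lt y z → lt x z)
    (hT : ∀ x y, T x y ↔ ¬ lt x y ∧ ¬ lt y x)
    (htw : ∀ x y, T x y → x ≠ v₀ → y ≠ v₀ → col x = col y → ∀ z, T x z → T y z) (γ : List C) :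
    ∀ v ∈ γ.foldl (call T col v₀) {v₀}, ∀ v' ∈ γ.foldl (call T col v₀) {v₀},
      ∃ r N u d, MoveSeq T col v₀ r N u d ∧ r + 1 ≤ (γ.foldl (call T col v₀) {v₀}).ncard ∧
        N + (complete col v₀ (γ.foldl (call T col v₀) {v₀})).card ≤ γ.length ∧
        Dominates lt u v ∧ Dominates (flip lt) d v' := by
  induction γ using List.reverseRecOn with
  | nil =>
    rintro v rfl v' rfl
    refine ⟨0, 0, v', v', .nil, by simp, ?_, fun x h => h, fun x h => h⟩
    have : complete col v' {v'} = ∅ := by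
      refine Finset.eq_empty_of_forall_notMem fun c hc => ?_
      obtain ⟨h1, h2⟩ := mem_complete.1 hc
      obtain ⟨x, h3, h4⟩ := mem_colors.1 h1
      exact h3 (h2 x h3 h4)
    simp [this]
  | append_singleton γ c ih =>
    rw [List.foldl_append, List.foldl_cons, List.foldl_nil, List.length_append,
      List.length_singleton]
    set W := γ.foldl (call T col v₀) {v₀} with hW
    -- Ineffective calls yield no move, which keeps the number of moves below the size of the
    -- territory.
    by_cases hWc : call T col v₀ W c = W
    · rw [hWc]
      intro v hv v' hv'
      obtain ⟨r, N, u, d, h1, h2, h3, h4⟩ := ih v hv v' hv'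
      exact ⟨r, N, u, d, h1, h2, by omega, h4⟩
    · have hss : W ⊂ call T col v₀ W c := (subset_call W c).ssubset_of_ne (Ne.symm hWc)
      have hcard := Set.ncard_lt_ncard hss (Set.toFinite _)
      obtain ⟨y, hy, hyW⟩ := Set.exists_of_ssubset hss
      have hyc : y ≠ v₀ ∧ col y = c := by
        rcases hy with hy | ⟨h0, h1, -⟩
        · exact absurd hy hyW
        · exact ⟨h0, h1⟩
      have hflip : ∀ x y z, flip lt x y → flip lt y z → flip lt x z :=
        fun a b c h1 h2 => htr _ _ _ h2 h1
      have hTflip : ∀ x y, T x y ↔ ¬ flip lt x y ∧ ¬ flip lt y x :=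
        fun a b => (hT a b).trans and_comm
      intro v hv v' hv'
      by_cases hcc : c ∈ complete col v₀ (call T col v₀ W c)
      · obtain ⟨w, hw, hw2⟩ := exists_move_of_complete hr hs htr hT htw hv hcc
        obtain ⟨w', hw', hw2'⟩ := exists_move_of_complete hr hs hflip hTflip htw hv' hcc
        obtain ⟨r, N, u, d, h1, h2, h3, h4, h5⟩ := ih w hw w' hw'
        obtain ⟨h6, u', h7, h8⟩ := hw2 u h4
        obtain ⟨h6', d', h7', h8'⟩ := hw2' d h5
        refine ⟨r + 1, _, u', d', .step h1 hyc.1 (hyc.2 ▸ h7) (hyc.2 ▸ h7'), by omega, ?_, h8, h8'⟩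
        -- An avoiding path would put both ends below or both above some node of color `c`, but `u`
        -- is below none and `d` is above none.
        have hcost : moveCost T col v₀ (col y) u d = 0 := by
          rw [moveCost, if_neg]
          rintro ⟨x, h0, h1, hA⟩
          rcases hA.lt_or_lt hr htr hT with h | h
          · exact h6 x h0 (h1.trans hyc.2) h.1
          · exact h6' x h0 (h1.trans hyc.2) h.2
        have : (complete col v₀ (call T col v₀ W c)).card ≤ (complete col v₀ W).card + 1 := by
          classical
          refine (Finset.card_le_card (t := insert c (complete col v₀ W)) fun a ha => ?_).trans
            (Finset.card_insert_le _ _)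
          rw [Finset.mem_insert]
          by_cases hac : a = c
          · exact .inl hac
          · exact .inr (mem_complete_of_call hac ha)
        omega
      · obtain ⟨w, hw, hw2⟩ := exists_move htr hT hv
        obtain ⟨w', hw', hw2'⟩ := exists_move hflip hTflip hv'
        obtain ⟨r, N, u, d, h1, h2, h3, h4, h5⟩ := ih w hw w' hw'
        obtain ⟨u', h7, h8⟩ := hw2 u h4
        obtain ⟨d', h7', h8'⟩ := hw2' d h5
        refine ⟨r + 1, _, u', d', .step h1 hyc.1 (hyc.2 ▸ h7) (hyc.2 ▸ h7'), by omega, ?_, h8, h8'⟩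
        have hcost := moveCost_le_one (T := T) (col := col) (v₀ := v₀) (col y) u d
        have : (complete col v₀ (call T col v₀ W c)).card ≤ (complete col v₀ W).card :=
          Finset.card_le_card fun a ha =>
            mem_complete_of_call (by rintro rfl; exact hcc ha) ha
        omega

/-- A conquering color sequence yields a move sequence to a goal. -/
theorem exists_moveSeq_of_conquering (hr : ∀ x, T x x) (hs : ∀ x y, T x y → T y x)
    (htr : ∀ x y z, lt x y → lt y z → lt x z)
    (hT : ∀ x y, T x y ↔ ¬ lt x y ∧ ¬ lt y x)
    (htw : ∀ x y, T x y → x ≠ v₀ → y ≠ v₀ → col x = col y → ∀ z, T x z → T y z) {γ : List C}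
    (hγ : γ.foldl (call T col v₀) {v₀} = Set.univ) :
    ∃ r N u d, MoveSeq T col v₀ r N u d ∧ IsGoal T u d ∧ r ≤ Fintype.card V ∧
      N + (colors col v₀).card ≤ γ.length := by
  have irr : ∀ x, ¬ lt x x := fun x => ((hT x x).1 (hr x)).1
  have wf : WellFounded lt := by
    have : IsTrans V lt := ⟨htr⟩
    have : Std.Irrefl lt := ⟨irr⟩
    exact Finite.wellFounded_of_trans_of_irrefl _
  have wf' : WellFounded (flip lt) := by
    have : IsTrans V (flip lt) := ⟨fun a b c h1 h2 => htr _ _ _ h2 h1⟩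
    have : Std.Irrefl (flip lt) := ⟨irr⟩
    exact Finite.wellFounded_of_trans_of_irrefl _
  -- Ends beyond a minimal `v'` and a maximal `v` have nothing outside them, which makes the pair a
  -- goal.
  obtain ⟨v', -, hv'⟩ := wf.has_min Set.univ ⟨v₀, trivial⟩
  obtain ⟨v, -, hv⟩ := wf'.has_min Set.univ ⟨v₀, trivial⟩
  obtain ⟨r, N, u, d, h1, h2, h3, h4, h5⟩ := exists_moveSeq_of_calls hr hs htr hT htw γ
    v (hγ ▸ trivial) v' (hγ ▸ trivial)
  rw [hγ] at h2 h3
  refine ⟨r, N, u, d, h1, fun x hA => ?_, ?_, ?_⟩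
  · rcases hA.lt_or_lt hr htr hT with h | h
    · exact hv x trivial (h4 x h.1)
    · exact hv' x trivial (h5 x h.2)
  · rw [Set.ncard_univ, Nat.card_eq_fintype_card] at h2
    omega
  · have : complete col v₀ Set.univ = colors col v₀ := by
      ext c
      simp [mem_complete]
    rwa [this] at h3

end Order

end Game

/-! ### Boolean expressions -/

namespace Expr

/-- Negation. -/
def not (e : Expr) : Expr := .sub (.lit 1) e
/-- Normalization to `0` or `1`. -/
def bool (e : Expr) : Expr := e.not.not
/-- Conjunction. -/
def and (e f : Expr) : Expr := (Expr.add e.not f.not).not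
/-- Equality. -/
def eq (e f : Expr) : Expr := (Expr.add (.sub e f) (.sub f e)).not
/-- Strict inequality. -/
def lt (e f : Expr) : Expr := .sub f e

variable (m : Memory) (e f : Expr)

theorem eval_not : e.not.eval m ≠ 0 ↔ ¬ e.eval m ≠ 0 := by
  simp only [not, eval]; omega

theorem eval_bool : e.bool.eval m = if e.eval m ≠ 0 then 1 else 0 := by
  simp only [bool, not, eval]; split_ifs <;> omega

theorem eval_and : (e.and f).eval m ≠ 0 ↔ e.eval m ≠ 0 ∧ f.eval m ≠ 0 := by
  simp only [and, not, eval]; omega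

theorem eval_or : (Expr.add e f).eval m ≠ 0 ↔ e.eval m ≠ 0 ∨ f.eval m ≠ 0 := by
  simp only [eval]; omega

theorem eval_eq : (e.eq f).eval m ≠ 0 ↔ e.eval m = f.eval m := by
  simp only [eq, not, eval]; omega

theorem eval_lt : (e.lt f).eval m ≠ 0 ↔ e.eval m < f.eval m := by
  simp only [lt, eval]; omega

/-- The entry of the array `A` at the values of the variables `x` and `y`. -/
def entry (A x y : ℕ) : Expr := .arr A (.var x) (.var y)
/-- The color of the node that is the value of the variable `x`. -/
def color (x : ℕ) : Expr := .arr 1 (.var x) (.lit 0)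

end Expr

namespace LoopProg

/-! ### Filling arrays and transitive closure -/

theorem fill_spec {A x y n : ℕ} {e : Expr} (f : Fin n → Fin n → ℕ) (m : Memory)
    (hwf : (nest [x, y] (setArr A (.var x) (.var y) e)).wf = true) (hn : m.var 0 = n)
    (he : ∀ s (i j : Fin n), Frame (nest [x, y] (setArr A (.var x) (.var y) e)) m s →
      s.var x = i → s.var y = j → e.eval s = f i j) (i j : Fin n) :
    ((nest [x, y] (setArr A (.var x) (.var y) e)).den m).arr A i j = f i j := by
  have hxy : y ≠ x := by
    rintro rfl
    simp [nest, wf, vars] at hwf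
  refine nest_hit (J := fun _ => True) (Q := fun a => a i j = f i j) [x, y] m hwf hn
    (fun _ _ _ _ _ => trivial) ?_ (fun v => if v = x then i else j) ?_ trivial
  · intro s σ hf hσ _ hq
    have hx := hσ x (by simp)
    have hy := hσ y (by simp)
    simp only [den, Memory.setArr, Expr.eval, hx, hy, he s _ _ hf hx hy, true_and]
    split_ifs with h
    · rw [Fin.ext h.1, Fin.ext h.2]
    · exact hq
  · intro s hf hσ _
    have hx := hσ x (by simp)
    have hy := hσ y (by simp)
    simp only [if_true, hxy, if_false] at hx hy
    simp only [den, Memory.setArr, Expr.eval, hx, hy, he s _ _ hf hx hy, and_self, if_true]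

/-- Hypothesis `h` makes the condition and the position depend on the loop indices only, not on
marks written earlier, so the order of the runs is irrelevant. -/
theorem mark_spec {A n : ℕ} {c e f : Expr} (xs : List ℕ) (m : Memory)
    (P : (ℕ → Fin n) → Prop) (k l : (ℕ → Fin n) → Fin n)
    (hwf : (nest xs (when c (setArr A e f (.lit 1)))).wf = true) (hn : m.var 0 = n)
    (h : ∀ s σ, Frame (nest xs (when c (setArr A e f (.lit 1)))) m s →
      (∀ x ∈ xs, s.var x = σ x) →
      (c.eval s ≠ 0 ↔ P σ) ∧ e.eval s = k σ ∧ f.eval s = l σ) (i j : Fin n) :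
    ((nest xs (when c (setArr A e f (.lit 1)))).den m).arr A i j ≠ 0 ↔
      m.arr A i j ≠ 0 ∨ ∃ σ, P σ ∧ k σ = i ∧ l σ = j := by
  have step : ∀ s σ, Frame (nest xs (when c (setArr A e f (.lit 1)))) m s →
      (∀ x ∈ xs, s.var x = σ x) →
      (((when c (setArr A e f (.lit 1))).den s).arr A i j ≠ 0 ↔
        s.arr A i j ≠ 0 ∨ (P σ ∧ k σ = i ∧ l σ = j)) := by
    intro s σ hf hσ
    obtain ⟨h1, h2, h3⟩ := h s σ hf hσ
    simp only [den]
    split_ifs with hP <;> rw [h1] at hP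
    · simp only [Memory.setArr, h2, h3, Expr.eval, true_and, Fin.val_inj]
      split_ifs with hij
      · simp [hP, hij.1, hij.2]
      · simp only [hP, true_and]
        refine ⟨.inl, fun h => h.resolve_right fun h' => hij ⟨h'.1.symm, h'.2.symm⟩⟩
    · simp [hP]
  have keep : ∀ s (σ : ℕ → Fin n), Frame (nest xs (when c (setArr A e f (.lit 1)))) m s →
      (∀ x ∈ xs, s.var x = σ x) → s.arr A i j ≠ 0 →
      ((when c (setArr A e f (.lit 1))).den s).arr A i j ≠ 0 :=
    fun s σ hf hσ hs => (step s σ hf hσ).2 (.inl hs)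
  constructor
  · refine fun hh => nest_inv (J := fun a => a i j ≠ 0 → m.arr A i j ≠ 0 ∨
      ∃ σ, P σ ∧ k σ = i ∧ l σ = j) xs m hwf hn ?_ (fun _ => i) .inl hh
    intro s σ hf hσ hJ hh
    rcases (step s σ hf hσ).1 hh with h1 | h1
    · exact hJ h1
    · exact .inr ⟨σ, h1⟩
  · rintro (hh | ⟨σ, hσ⟩)
    · exact nest_inv (J := fun a => a i j ≠ 0) xs m hwf hn keep (fun _ => i) hh
    · exact nest_hit (J := fun _ => True) (Q := fun a => a i j ≠ 0) xs m hwf hn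
        (fun _ _ _ _ _ => trivial) (fun s σ hf hσ _ => keep s σ hf hσ) σ
        (fun s hf hs _ => (step s σ hf hs).2 (.inr hσ)) trivial

/-- Transitive closure of the relation that is given by the array `A`. -/
def closure (A : ℕ) : LoopProg :=
  nest [8, 9, 10] (when (.and (.entry A 9 8) (.entry A 8 10))
    (setArr A (.var 9) (.var 10) (.lit 1)))

/-- `i` and `j` are connected by a path all of whose inner nodes are smaller than `k`. -/
def ConnBelow {n : ℕ} (r : Fin n → Fin n → Prop) : ℕ → Fin n → Fin n → Prop
  | 0, i, j => r i j
  | k + 1, i, j => ConnBelow r k i j ∨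
      ∃ h : k < n, ConnBelow r k i ⟨k, h⟩ ∧ ConnBelow r k ⟨k, h⟩ j

theorem ConnBelow.trans {n : ℕ} {r : Fin n → Fin n → Prop} {k : ℕ} {i l j : Fin n}
    (hl : (l : ℕ) < k) (h : ConnBelow r k i l) (h' : ConnBelow r k l j) : ConnBelow r k i j := by
  induction k generalizing i l j with
  | zero => omega
  | succ k ih =>
    by_cases hlk : (l : ℕ) < k
    · rcases h with h | ⟨hk, h1, h2⟩ <;> rcases h' with h' | ⟨hk, h3, h4⟩
      · exact .inl (ih hlk h h')
      · exact .inr ⟨hk, ih hlk h h3, h4⟩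
      · exact .inr ⟨hk, h1, ih hlk h2 h'⟩
      · exact .inr ⟨hk, h1, h4⟩
    · obtain rfl : (l : ℕ) = k := by omega
      have h1 : ConnBelow r l i l := by
        rcases h with h | ⟨_, h, -⟩ <;> exact h
      have h2 : ConnBelow r l l j := by
        rcases h' with h | ⟨_, -, h⟩ <;> exact h
      exact .inr ⟨l.2, h1, h2⟩

theorem ConnBelow.of_transGen {n : ℕ} {r : Fin n → Fin n → Prop} {i j : Fin n}
    (h : Relation.TransGen r i j) : ConnBelow r n i j := by
  have base : ∀ k {i j}, r i j → ConnBelow r k i j := by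
    intro k
    induction k with
    | zero => exact fun h => h
    | succ k ih => exact fun h => .inl (ih h)
  induction h with
  | single h => exact base n h
  | @tail b c _ h ih => exact ih.trans b.2 (base n h)

/-- Warshall's algorithm. Updating in place is harmless: marks are never removed, and every mark set
early is still sound for the transitive closure. -/
theorem closure_spec {A n : ℕ} {m : Memory} (hn : m.var 0 = n) (i j : Fin n) :
    ((closure A).den m).arr A i j ≠ 0 ↔
      Relation.TransGen (fun a b : Fin n => m.arr A a b ≠ 0) i j := by
  set r := fun a b : Fin n => m.arr A a b ≠ 0 with hr
  have step : ∀ (s : Memory) (σ : ℕ → Fin n) (a b : Fin n), s.var 8 = σ 8 → s.var 9 = σ 9 →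
      s.var 10 = σ 10 →
      (((when (.and (.entry A 9 8) (.entry A 8 10))
        (setArr A (.var 9) (.var 10) (.lit 1))).den s).arr A a b ≠ 0 ↔
        s.arr A a b ≠ 0 ∨ (a = σ 9 ∧ b = σ 10 ∧ s.arr A (σ 9) (σ 8) ≠ 0 ∧
          s.arr A (σ 8) (σ 10) ≠ 0)) := by
    intro s σ a b h8 h9 h10
    simp only [den, Expr.eval_and, Expr.entry, Expr.eval, h8, h9, h10]
    split_ifs with hc
    · simp only [Memory.setArr, true_and, Fin.val_inj]
      split_ifs with hab
      · simp [hab.1, hab.2, hc]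
      · refine ⟨.inl, fun h => h.resolve_right fun h' => hab ⟨h'.1, h'.2.1⟩⟩
    · refine ⟨.inl, fun h => h.resolve_right fun h' => hc h'.2.2⟩
  have hwf : (closure A).wf = true := rfl
  constructor
  · refine nest_inv (J := fun a => ∀ i j : Fin n, a i j ≠ 0 → Relation.TransGen r i j)
      [8, 9, 10] m hwf hn ?_ (fun _ => i) (fun i j h => .single h) i j
    intro s σ hf hσ hJ a b hab
    rcases (step s σ a b (hσ 8 (by simp)) (hσ 9 (by simp)) (hσ 10 (by simp))).1 hab with
      h | ⟨rfl, rfl, h1, h2⟩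
    · exact hJ a b h
    · exact (hJ _ _ h1).trans (hJ _ _ h2)
  · intro h
    have main := loop_rule (x := 8) (A := A) (m := m) (p := nest [9, 10]
        (when (.and (.entry A 9 8) (.entry A 8 10)) (setArr A (.var 9) (.var 10) (.lit 1))))
      (I := fun k a => ∀ i j : Fin n, ConnBelow r k i j → a i j ≠ 0) (fun i j h => h) (by
        intro k hk s hs hf hI a b hab
        rw [hn] at hk
        have hwf' : (nest [9, 10] (when (.and (.entry A 9 8) (.entry A 8 10))
          (setArr A (.var 9) (.var 10) (.lit 1)))).wf = true := rfl
        have hn' : s.var 0 = n := by rw [hf.var 0 (by simp [vars, nest]), hn]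
        have stp : ∀ (s' : Memory) (σ : ℕ → Fin n) (a b : Fin n), Frame (nest [9, 10]
            (when (.and (.entry A 9 8) (.entry A 8 10))
              (setArr A (.var 9) (.var 10) (.lit 1)))) s s' →
            (∀ x ∈ [9, 10], s'.var x = σ x) → _ := fun s' σ a b h1 h2 =>
          step s' (Function.update σ 8 ⟨k, hk⟩) a b
            (by rw [h1.var 8 (by simp [vars, nest]), hs]; simp)
            (by rw [h2 9 (by simp)]; simp)
            (by rw [h2 10 (by simp)]; simp)
        have hJ : ∀ (s' : Memory) (σ : ℕ → Fin n), Frame (nest [9, 10]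
            (when (.and (.entry A 9 8) (.entry A 8 10))
              (setArr A (.var 9) (.var 10) (.lit 1)))) s s' →
            (∀ x ∈ [9, 10], s'.var x = σ x) →
            (∀ a b : Fin n, ConnBelow r k a b → s'.arr A a b ≠ 0) →
            (∀ a b : Fin n, ConnBelow r k a b → ((when (.and (.entry A 9 8) (.entry A 8 10))
              (setArr A (.var 9) (.var 10) (.lit 1))).den s').arr A a b ≠ 0) :=
          fun s' σ h1 h2 h3 a b hab => (stp s' σ a b h1 h2).2 (.inl (h3 a b hab))
        rcases hab with hab | ⟨_, h1, h2⟩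
        · exact nest_inv (J := fun t => ∀ i j : Fin n, ConnBelow r k i j → t i j ≠ 0)
            [9, 10] s hwf' hn' hJ (fun _ => i) hI a b hab
        · refine nest_hit (J := fun t => ∀ i j : Fin n, ConnBelow r k i j → t i j ≠ 0)
            (Q := fun t => t a b ≠ 0) [9, 10] s hwf' hn' hJ
            (fun s' σ h1 h2 _ h3 => (stp s' σ a b h1 h2).2 (.inl h3))
            (fun v => if v = 9 then a else b) (fun s' h3 h4 h5 => ?_) hI
          refine (stp s' _ a b h3 h4).2 (.inr ⟨?_, ?_, ?_, ?_⟩)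
          · simp
          · simp
          · simpa using h5 _ _ h1
          · simpa using h5 _ _ h2)
    rw [hn] at main
    exact main i j (ConnBelow.of_transGen h)

end LoopProg

open LoopProg

/-! ### The algorithm -/

/-- The relation of touching on the nodes of an instance. -/
abbrev Instance.touch (I : Instance) : Fin I.n → Fin I.n → Prop := Touch I.graph I.col I.start

/-- Inequality of the values of two variables. -/
def ne (x y : ℕ) : Expr := (Expr.eq (.var x) (.var y)).not

/-- The nodes in `x` and `y` have the same color. -/
def sameColor (x y : ℕ) : Expr := .eq (.color x) (.color y)

/-- The first step towards the blocks, in array `2`. -/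
def blockInit : LoopProg :=
  nest [4, 5] (.setArr 2 (.var 4) (.var 5) (.bool (.add (.eq (.var 4) (.var 5))
    (.and (.entry 0 4 5) (.and (sameColor 4 5) (.and (ne 4 2) (ne 5 2)))))))

/-- The relation of touching, in array `3`. -/
def markTouch : LoopProg :=
  nest [4, 5, 6, 7] (.when (.and (.entry 2 4 5) (.and
    (.add (.eq (.var 5) (.var 6)) (.entry 0 5 6)) (.entry 2 6 7)))
    (.setArr 3 (.var 4) (.var 7) (.lit 1)))

/-- The number of colors, in the cell `(0, 1)` of array `7`. -/
def countColors : LoopProg :=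
  .loop 4 (.when (.and (ne 4 2) (Expr.not (.arr 7 (.color 4) (.lit 0))))
    (.seq (.setArr 7 (.color 4) (.lit 0) (.lit 1))
      (.setArr 7 (.lit 0) (.lit 1) (.add (.arr 7 (.lit 0) (.lit 1)) (.lit 1)))))

/-- Initial upper bounds for the costs of all pairs, in array `4`. -/
def costInit : LoopProg :=
  .seq (nest [4, 5] (.setArr 4 (.var 4) (.var 5) (.add (.var 3) (.lit 1))))
    (.setArr 4 (.var 2) (.var 2) (.lit 0))

/-- The first step towards the paths of nodes that do not touch the node in variable `7`,
in array `6`. -/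
def avoidInit : LoopProg :=
  nest [8, 9] (.setArr 6 (.var 8) (.var 9)
    (.bool (.and (.entry 3 8 9) (.and (.not (.entry 3 7 8)) (.not (.entry 3 7 9))))))

/-- In array `5`, marking the pairs that are marked in array `6`. -/
def copyMarks : LoopProg :=
  nest [8, 9] (.when (.entry 6 8 9) (.setArr 5 (.var 8) (.var 9) (.lit 1)))

/-- In array `5`, the pairs for which some node that satisfies `e` can be avoided. -/
def avoidable (e : Expr) : LoopProg :=
  .seq (nest [8, 9] (.setArr 5 (.var 8) (.var 9) (.lit 0)))
    (nest [7] (.when e (.seq (.seq avoidInit (closure 6)) copyMarks)))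

/-- A move from the node in `x` to the node in `y`. -/
def moveExpr (x y : ℕ) : Expr :=
  .add (.eq (.var y) (.var x)) (.and (.entry 3 x y) (.and (ne y 2) (sameColor y 5)))

/-- The cost after one more move. -/
def newCost : Expr := .add (.entry 4 8 9) (.bool (.entry 5 8 9))

/-- Improving the cost of one pair. -/
def relaxPair : LoopProg :=
  .when (.and (.and (moveExpr 8 10) (moveExpr 9 11)) (.lt newCost (.entry 4 10 11)))
    (.setArr 4 (.var 10) (.var 11) newCost)

/-- Improving the costs by the color of the node in variable `5`. -/
def relaxColor : LoopProg :=
  .when (ne 5 2) (.seq (avoidable (.and (ne 7 2) (sameColor 7 5)))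
    (nest [8, 9, 10, 11] relaxPair))

/-- The answer, in the cell of array `8` that belongs to the start node. -/
def answer : LoopProg :=
  nest [4, 5] (.when (.and (.not (.entry 5 4 5))
    (.not (.lt (.var 3) (.add (.entry 4 4 5) (.arr 7 (.lit 0) (.lit 1))))))
    (.setArr 8 (.var 2) (.var 2) (.lit 1)))

/-- The program without the output instruction. -/
def solver : LoopProg :=
  .seq blockInit <| .seq (closure 2) <| .seq markTouch <| .seq countColors <| .seq costInit <|
    .seq (nest [4, 5] relaxColor) <| .seq (avoidable (.lit 1)) answer

/-! ### Correctness -/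

/-- The memory holds the input. -/
structure HoldsInput (I : Instance) (m : Memory) : Prop where
  nodes : m.var 0 = I.n
  start : m.var 2 = I.start
  bound : m.var 3 = I.bound
  adj : ∀ i j : Fin I.n, m.arr 0 i j ≠ 0 ↔ I.graph.Adj i j
  col : ∀ i : Fin I.n, m.arr 1 i 0 = I.col i

/-- The memory holds the input and the relation of touching. -/
structure HoldsTouch (I : Instance) (m : Memory) : Prop extends HoldsInput I m where
  touch : ∀ i j : Fin I.n, m.arr 3 i j ≠ 0 ↔ I.touch i j

variable {I : Instance} {m s : Memory} {p : LoopProg}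

theorem holdsInput_memory (I : Instance) : HoldsInput I I.memory where
  nodes := rfl
  start := rfl
  bound := rfl
  adj i j := by simp [Instance.memory]
  col i := by simp [Instance.memory]

theorem HoldsInput.frame (h : HoldsInput I m) (hf : Frame p m s)
    (hv : ∀ x ∈ [0, 2, 3], x ∉ p.vars) (ha : ∀ A ∈ [0, 1], A ∉ p.arrs) : HoldsInput I s where
  nodes := by rw [hf.var 0 (hv 0 (by simp)), h.nodes]
  start := by rw [hf.var 2 (hv 2 (by simp)), h.start]
  bound := by rw [hf.var 3 (hv 3 (by simp)), h.bound]
  adj i j := by rw [hf.arr 0 (ha 0 (by simp)), h.adj]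
  col i := by rw [hf.arr 1 (ha 1 (by simp)), h.col]

theorem HoldsTouch.frame (h : HoldsTouch I m) (hf : Frame p m s)
    (hv : ∀ x ∈ [0, 2, 3], x ∉ p.vars) (ha : ∀ A ∈ [0, 1, 3], A ∉ p.arrs) : HoldsTouch I s where
  toHoldsInput := h.toHoldsInput.frame hf hv fun A hA => ha A (by simp at hA ⊢; tauto)
  touch i j := by rw [hf.arr 3 (ha 3 (by simp)), h.touch]

theorem frame_den (p : LoopProg) (m : Memory) : Frame p m (p.den m) :=
  ⟨fun _ hx => den_var hx m, fun _ hA => den_arr hA m⟩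

theorem HoldsInput.den (h : HoldsInput I m) (hv : ∀ x ∈ [0, 2, 3], x ∉ p.vars)
    (ha : ∀ A ∈ [0, 1], A ∉ p.arrs) : HoldsInput I (p.den m) :=
  h.frame (frame_den p m) hv ha

theorem HoldsTouch.den (h : HoldsTouch I m) (hv : ∀ x ∈ [0, 2, 3], x ∉ p.vars)
    (ha : ∀ A ∈ [0, 1, 3], A ∉ p.arrs) : HoldsTouch I (p.den m) :=
  h.frame (frame_den p m) hv ha

theorem HoldsInput.eval_sameColor (h : HoldsInput I m) {x y : ℕ} {i j : Fin I.n}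
    (hx : m.var x = i) (hy : m.var y = j) :
    (sameColor x y).eval m ≠ 0 ↔ I.col i = I.col j := by
  rw [sameColor, Expr.eval_eq]
  simp [Expr.color, Expr.eval, hx, hy, h.col, Fin.val_inj]

theorem HoldsInput.eval_ne_start (h : HoldsInput I m) {x : ℕ} {i : Fin I.n}
    (hx : m.var x = i) : (ne x 2).eval m ≠ 0 ↔ i ≠ I.start := by
  rw [ne, Expr.eval_not, Expr.eval_eq]
  simp [Expr.eval, hx, h.start, Fin.val_inj]

theorem eval_entry {A x y n : ℕ} {i j : Fin n} (hx : m.var x = i) (hy : m.var y = j) :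
    (Expr.entry A x y).eval m = m.arr A i j := by
  simp [Expr.entry, Expr.eval, hx, hy]

theorem eval_eq_var {x y n : ℕ} {i j : Fin n} (hx : m.var x = i) (hy : m.var y = j) :
    (Expr.eq (.var x) (.var y)).eval m ≠ 0 ↔ i = j := by
  rw [Expr.eval_eq]
  simp [Expr.eval, hx, hy, Fin.val_inj]

theorem block_spec (h : HoldsInput I m) (i j : Fin I.n) :
    ((closure 2).den (blockInit.den m)).arr 2 i j ≠ 0 ↔ Block I.graph I.col I.start i j := by
  classical
  rw [closure_spec ((h.den (p := blockInit) (by decide) (by decide)).nodes)]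
  unfold Block
  have : ∀ a b : Fin I.n, (blockInit.den m).arr 2 a b ≠ 0 ↔
      a = b ∨ (I.graph.Adj a b ∧ I.col a = I.col b ∧ a ≠ I.start ∧ b ≠ I.start) := by
    intro a b
    rw [blockInit, fill_spec (fun a b => if a = b ∨ (I.graph.Adj a b ∧ I.col a = I.col b ∧
      a ≠ I.start ∧ b ≠ I.start) then 1 else 0) m rfl h.nodes]
    · rw [ite_ne_right_iff]
      exact and_iff_left one_ne_zero
    · intro s a b hf ha hb
      have hs := h.frame hf (by decide) (by decide)
      rw [Expr.eval_bool]
      congr 1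
      rw [Expr.eval_or, Expr.eval_and, Expr.eval_and, Expr.eval_and, eval_eq_var ha hb,
        eval_entry ha hb, hs.adj, hs.eval_sameColor ha hb, hs.eval_ne_start ha,
        hs.eval_ne_start hb]
  simp only [this]

theorem touch_spec (h : HoldsInput I m) (h3 : ∀ i j : Fin I.n, m.arr 3 i j = 0)
    (hb : ∀ i j : Fin I.n, m.arr 2 i j ≠ 0 ↔ Block I.graph I.col I.start i j) (i j : Fin I.n) :
    (markTouch.den m).arr 3 i j ≠ 0 ↔ I.touch i j := by
  rw [markTouch, mark_spec [4, 5, 6, 7] m (fun σ : ℕ → Fin I.n =>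
    Block I.graph I.col I.start (σ 4) (σ 5) ∧ (σ 5 = σ 6 ∨ I.graph.Adj (σ 5) (σ 6)) ∧
      Block I.graph I.col I.start (σ 6) (σ 7)) (fun σ => σ 4) (fun σ => σ 7) rfl h.nodes]
  · rw [h3]
    constructor
    · rintro (h | ⟨σ, h1, rfl, rfl⟩)
      · exact absurd rfl h
      · exact ⟨σ 5, σ 6, h1⟩
    · rintro ⟨x, y, hxy⟩
      exact .inr ⟨fun v => if v = 4 then i else if v = 5 then x else if v = 6 then y else j,
        by simpa using hxy, by simp, by simp⟩
  · intro s σ hf hσ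
    have hs := h.frame hf (by decide) (by decide)
    have h2 := hf.arr 2 (by decide)
    refine ⟨?_, hσ 4 (by simp), hσ 7 (by simp)⟩
    rw [Expr.eval_and, Expr.eval_and, Expr.eval_or, eval_entry (hσ 4 (by simp)) (hσ 5 (by simp)),
      eval_entry (hσ 5 (by simp)) (hσ 6 (by simp)), eval_entry (hσ 6 (by simp)) (hσ 7 (by simp)),
      eval_eq_var (hσ 5 (by simp)) (hσ 6 (by simp)), hs.adj, h2, hb, hb]

/-- After `j` rounds, column 0 flags the colors of the nodes below `j` other than the start node,
and cell `(0, 1)` holds their number. Keeping the counter in column 1 separates it from the flags.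
-/
theorem countColors_spec (h : HoldsInput I m) (h7 : ∀ i j, m.arr 7 i j = 0) :
    (countColors.den m).arr 7 0 1 = (colors I.col I.start).card := by
  classical
  let S : ℕ → Finset (Fin I.k) := fun j =>
    (Finset.univ.filter fun x : Fin I.n => x ≠ I.start ∧ (x : ℕ) < j).image I.col
  have hS : ∀ j c, c ∈ S j ↔ ∃ x : Fin I.n, (x ≠ I.start ∧ (x : ℕ) < j) ∧ I.col x = c := by
    intro j c
    simp [S]
  have main := loop_rule (x := 4) (A := 7) (m := m)
    (p := .when (.and (ne 4 2) (Expr.not (.arr 7 (.color 4) (.lit 0))))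
      (.seq (.setArr 7 (.color 4) (.lit 0) (.lit 1))
        (.setArr 7 (.lit 0) (.lit 1) (.add (.arr 7 (.lit 0) (.lit 1)) (.lit 1)))))
    (I := fun j a => (∀ c : Fin I.k, a c 0 ≠ 0 ↔ c ∈ S j) ∧ a 0 1 = (S j).card)
    (by simp [h7, S]) (by
      intro j hj s hsx hf ⟨h1, h2⟩
      have hs := h.frame hf (by decide) (by decide)
      rw [h.nodes] at hj
      set i : Fin I.n := ⟨j, hj⟩ with hi
      have hsx' : s.var 4 = i := hsx
      have hcol : (Expr.color 4).eval s = I.col i := by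
        simp [Expr.color, Expr.eval, hsx', hs.col]
      have hSj : ∀ c, c ∈ S (j + 1) ↔ c ∈ S j ∨ (i ≠ I.start ∧ I.col i = c) := by
        intro c
        rw [hS, hS]
        constructor
        · rintro ⟨x, ⟨hx0, hx⟩, hxc⟩
          by_cases hxj : (x : ℕ) = j
          · obtain rfl : x = i := Fin.ext hxj
            exact .inr ⟨hx0, hxc⟩
          · exact .inl ⟨x, ⟨hx0, by omega⟩, hxc⟩
        · rintro (⟨x, ⟨hx0, hx⟩, hxc⟩ | ⟨h0, hc⟩)
          · exact ⟨x, ⟨hx0, by omega⟩, hxc⟩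
          · exact ⟨i, ⟨h0, by simp [hi]⟩, hc⟩
      have harr : (Expr.arr 7 (.color 4) (.lit 0)).eval s ≠ 0 ↔ I.col i ∈ S j := by
        rw [← h1, Expr.eval, hcol, Expr.eval]
      simp only [LoopProg.den]
      rw [if_congr (by rw [Expr.eval_and, Expr.eval_not, hs.eval_ne_start hsx', harr]) rfl rfl]
      split_ifs with hc
      · have hins : S (j + 1) = insert (I.col i) (S j) := by
          ext c
          rw [hSj, Finset.mem_insert]
          constructor
          · rintro (h | h)
            · exact .inr h
            · exact .inl h.2.symm
          · rintro (h | h)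
            · exact .inr ⟨hc.1, h.symm⟩
            · exact .inl h
        constructor
        · intro c
          rw [hins, Finset.mem_insert, ← h1]
          simp only [Memory.setArr, hcol, Expr.eval, true_and]
          by_cases hci : c = I.col i
          · simp [hci]
          · simp [hci, Fin.val_inj]
        · rw [hins, Finset.card_insert_of_notMem hc.2, ← h2]
          simp [Memory.setArr, Expr.eval]
      · have hsame : S (j + 1) = S j := by
          ext c
          rw [hSj]
          refine ⟨?_, .inl⟩
          rintro (h | ⟨h0, rfl⟩)
          · exact h
          · by_contra hn
            exact hc ⟨h0, hn⟩
        rw [hsame]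
        exact ⟨h1, h2⟩)
  rw [countColors, main.2, h.nodes]
  congr 1
  ext c
  rw [hS, mem_colors]
  simp

theorem avoid_spec (h : HoldsTouch I m) {x : Fin I.n} (hx : m.var 7 = x) (i j : Fin I.n) :
    ((closure 6).den (avoidInit.den m)).arr 6 i j ≠ 0 ↔ Avoid I.touch x i j := by
  classical
  rw [closure_spec ((h.den (p := avoidInit) (by decide) (by decide)).nodes)]
  unfold Avoid
  have : ∀ a b : Fin I.n, (avoidInit.den m).arr 6 a b ≠ 0 ↔
      I.touch a b ∧ ¬ I.touch x a ∧ ¬ I.touch x b := by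
    intro a b
    rw [avoidInit, fill_spec (fun a b => if I.touch a b ∧ ¬ I.touch x a ∧ ¬ I.touch x b
      then 1 else 0) m rfl h.nodes]
    · simp
    · intro s a b hf ha hb
      have hs := h.frame hf (by decide) (by decide)
      have hx' : s.var 7 = x := by rw [hf.var 7 (by decide), hx]
      rw [Expr.eval_bool]
      congr 1
      rw [Expr.eval_and, Expr.eval_and, Expr.eval_not, Expr.eval_not, eval_entry ha hb,
        eval_entry hx' ha, eval_entry hx' hb, hs.touch, hs.touch, hs.touch]
  simp only [this]

theorem copyMarks_spec (h : HoldsInput I m) (i j : Fin I.n) :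
    (copyMarks.den m).arr 5 i j ≠ 0 ↔ m.arr 5 i j ≠ 0 ∨ m.arr 6 i j ≠ 0 := by
  rw [copyMarks, mark_spec [8, 9] m (fun σ : ℕ → Fin I.n => m.arr 6 (σ 8) (σ 9) ≠ 0)
    (fun σ => σ 8) (fun σ => σ 9) rfl h.nodes]
  · refine or_congr Iff.rfl ⟨?_, fun hh => ?_⟩
    · rintro ⟨σ, h, rfl, rfl⟩
      exact h
    · exact ⟨fun v => if v = 8 then i else j, by simpa using hh, by simp, by simp⟩
  · intro s σ hf hσ
    refine ⟨?_, hσ 8 (by simp), hσ 9 (by simp)⟩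
    rw [eval_entry (hσ 8 (by simp)) (hσ 9 (by simp)), hf.arr 6 (by decide)]

theorem avoidable_spec (h : HoldsTouch I m) {e : Expr} (P : Fin I.n → Prop)
    (he : ∀ s (x : Fin I.n), Frame (avoidable e) m s → s.var 7 = x → (e.eval s ≠ 0 ↔ P x))
    (i j : Fin I.n) :
    ((avoidable e).den m).arr 5 i j ≠ 0 ↔ ∃ x, P x ∧ Avoid I.touch x i j := by
  classical
  set body := LoopProg.when e (.seq (.seq avoidInit (closure 6)) copyMarks) with hbody
  set m' := (nest [8, 9] (.setArr 5 (.var 8) (.var 9) (.lit 0))).den m with hm'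
  have hzero : ∀ i j : Fin I.n, m'.arr 5 i j = 0 :=
    fill_spec (fun _ _ => 0) m rfl h.nodes fun _ _ _ _ _ _ => rfl
  have hm : HoldsTouch I m' := h.den (by decide) (by decide)
  have hf1 : Frame (nest [8, 9] (.setArr 5 (.var 8) (.var 9) (.lit 0))) m m' := frame_den _ _
  have hvars : (nest [7] body).vars = [7, 8, 9, 8, 9, 10, 8, 9] := rfl
  have harrs : (nest [7] body).arrs = [6, 6, 5] := rfl
  have step : ∀ s (x : Fin I.n), Frame (nest [7] body) m' s → s.var 7 = x →
      ((body.den s).arr 5 i j ≠ 0 ↔ s.arr 5 i j ≠ 0 ∨ (P x ∧ Avoid I.touch x i j)) := by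
    intro s x hf hx
    have hs : HoldsTouch I s := hm.frame hf (by rw [hvars]; decide) (by rw [harrs]; decide)
    have hfs : Frame (avoidable e) m s := by
      constructor
      · intro y hy
        simp only [avoidable, vars, List.mem_append, not_or] at hy
        rw [hf.var y hy.2, hf1.var y hy.1]
      · intro A hA
        simp only [avoidable, arrs, List.mem_append, not_or] at hA
        rw [hf.arr A hA.2, hf1.arr A hA.1]
    rw [hbody]
    simp only [LoopProg.den]
    rw [if_congr (he s x hfs hx) rfl rfl]
    split_ifs with hP
    · rw [copyMarks_spec, avoid_spec hs hx, LoopProg.den_arr (by decide),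
        LoopProg.den_arr (by decide)]
      · simp [hP]
      · exact ((hs.den (p := avoidInit) (by decide) (by decide)).den (p := closure 6)
          (by decide) (by decide)).toHoldsInput
    · simp [hP]
  have hwf : (nest [7] body).wf = true := rfl
  have hseq : (avoidable e).den m = (nest [7] body).den m' := rfl
  rw [hseq]
  constructor
  · refine fun hh => nest_inv (J := fun a => a i j ≠ 0 → ∃ x, P x ∧ Avoid I.touch x i j) [7] m'
      hwf hm.nodes ?_ (fun _ => i) (fun h => absurd (hzero i j) h) hh
    intro s σ hf hσ hJ hh
    rcases (step s (σ 7) hf (hσ 7 (by simp))).1 hh with h1 | h1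
    · exact hJ h1
    · exact ⟨_, h1⟩
  · rintro ⟨x, hx⟩
    exact nest_hit (J := fun _ => True) (Q := fun a => a i j ≠ 0) [7] m' hwf hm.nodes
      (fun _ _ _ _ _ => trivial)
      (fun s σ hf hσ _ hh => (step s (σ 7) hf (hσ 7 (by simp))).2 (.inl hh)) (fun _ => x)
      (fun s hf hs _ => (step s x hf (hs 7 (by simp))).2 (.inr hx)) trivial

/-! ### Bellman–Ford on pairs of nodes -/

/-- Upper bounds for the costs that are at most the bound are attained by move sequences. -/
def Attained (I : Instance) (a : ℕ → ℕ → ℕ) : Prop :=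
  ∀ u d : Fin I.n, a u d ≤ I.bound →
    ∃ r N, MoveSeq I.touch I.col I.start r N u d ∧ N ≤ a u d

/-- The array `a` bounds the costs of all sequences of at most `k` moves from below. -/
def BelowCosts (I : Instance) (k : ℕ) (a : ℕ → ℕ → ℕ) : Prop :=
  ∀ r N, ∀ u d : Fin I.n, r ≤ k → MoveSeq I.touch I.col I.start r N u d → a u d ≤ N

theorem HoldsTouch.eval_moveExpr (h : HoldsTouch I m) {x z : ℕ} {u u' y : Fin I.n}
    (hx : m.var x = u) (hz : m.var z = u') (hy : m.var 5 = y) :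
    (moveExpr x z).eval m ≠ 0 ↔ Move I.touch I.col I.start (I.col y) u u' := by
  rw [moveExpr, Expr.eval_or, Expr.eval_and, Expr.eval_and, eval_eq_var hz hx, eval_entry hx hz,
    h.touch, h.eval_ne_start hz, h.eval_sameColor hz hy, Move]

/-- Either the pair needs no improvement, or both moves are legal and the strictly smaller cost is
written. -/
theorem relaxPair_arr (h : HoldsTouch I m) {y u d u' d' : Fin I.n} (hy : m.var 5 = y)
    (hu : m.var 8 = u) (hd : m.var 9 = d) (hu' : m.var 10 = u') (hd' : m.var 11 = d')
    (h5 : ∀ u d : Fin I.n, m.arr 5 u d ≠ 0 ↔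
      ∃ x, (x ≠ I.start ∧ I.col x = I.col y) ∧ Avoid I.touch x u d) :
    (relaxPair.den m).arr 4 = m.arr 4 ∧
      (Move I.touch I.col I.start (I.col y) u u' → Move I.touch I.col I.start (I.col y) d d' →
        m.arr 4 u' d' ≤ m.arr 4 u d + moveCost I.touch I.col I.start (I.col y) u d) ∨
    Move I.touch I.col I.start (I.col y) u u' ∧ Move I.touch I.col I.start (I.col y) d d' ∧
      m.arr 4 u d + moveCost I.touch I.col I.start (I.col y) u d < m.arr 4 u' d' ∧
      ∀ i j : Fin I.n, (relaxPair.den m).arr 4 i j = if i = u' ∧ j = d' then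
        m.arr 4 u d + moveCost I.touch I.col I.start (I.col y) u d else m.arr 4 i j := by
  classical
  have hcost : newCost.eval m =
      m.arr 4 u d + moveCost I.touch I.col I.start (I.col y) u d := by
    rw [newCost, Expr.eval, Expr.eval_bool, eval_entry hu hd, eval_entry hu hd, moveCost]
    congr 2
    rw [h5]
    simp only [and_assoc]
  simp only [relaxPair, LoopProg.den]
  rw [if_congr (by rw [Expr.eval_and, Expr.eval_and, h.eval_moveExpr hu hu' hy,
    h.eval_moveExpr hd hd' hy, Expr.eval_lt, hcost, eval_entry hu' hd']) rfl rfl]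
  split_ifs with hc
  · refine .inr ⟨hc.1.1, hc.1.2, hc.2, fun i j => ?_⟩
    simp only [Memory.setArr, Expr.eval, hu', hd', hcost, true_and, Fin.val_inj]
  · exact .inl ⟨rfl, fun h1 h2 => not_lt.1 fun h3 => hc ⟨⟨h1, h2⟩, h3⟩⟩

theorem relax_spec (h : HoldsTouch I m) {y : Fin I.n} (hy : m.var 5 = y) (hy0 : y ≠ I.start)
    (h5 : ∀ u d : Fin I.n, m.arr 5 u d ≠ 0 ↔
      ∃ x, (x ≠ I.start ∧ I.col x = I.col y) ∧ Avoid I.touch x u d) :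
    (∀ u d : Fin I.n, ((nest [8, 9, 10, 11] relaxPair).den m).arr 4 u d ≤ m.arr 4 u d) ∧
    (Attained I (m.arr 4) → Attained I (((nest [8, 9, 10, 11] relaxPair).den m).arr 4)) ∧
    ∀ u d u' d', Move I.touch I.col I.start (I.col y) u u' →
      Move I.touch I.col I.start (I.col y) d d' →
      ((nest [8, 9, 10, 11] relaxPair).den m).arr 4 u' d' ≤
        m.arr 4 u d + moveCost I.touch I.col I.start (I.col y) u d := by
  have step : ∀ s (σ : ℕ → Fin I.n), Frame (nest [8, 9, 10, 11] relaxPair) m s →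
      (∀ x ∈ [8, 9, 10, 11], s.var x = σ x) → _ := fun s σ hf hσ =>
    relaxPair_arr (h.frame hf (by decide) (by decide)) (y := y)
      (by rw [hf.var 5 (by decide), hy]) (hσ 8 (by simp)) (hσ 9 (by simp)) (hσ 10 (by simp))
      (hσ 11 (by simp)) (by rw [hf.arr 5 (by decide)]; exact h5)
  have hle : ∀ s (σ : ℕ → Fin I.n), Frame (nest [8, 9, 10, 11] relaxPair) m s →
      (∀ x ∈ [8, 9, 10, 11], s.var x = σ x) →
      ∀ i j : Fin I.n, (relaxPair.den s).arr 4 i j ≤ s.arr 4 i j := by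
    intro s σ hf hσ i j
    rcases step s σ hf hσ with ⟨h1, -⟩ | ⟨-, -, h1, h2⟩
    · rw [h1]
    · rw [h2]
      split_ifs with hij
      · rw [hij.1, hij.2]
        exact h1.le
      · exact le_rfl
  have hwf : (nest [8, 9, 10, 11] relaxPair).wf = true := rfl
  have hJ : ∀ s (σ : ℕ → Fin I.n), Frame (nest [8, 9, 10, 11] relaxPair) m s →
      (∀ x ∈ [8, 9, 10, 11], s.var x = σ x) →
      (∀ i j : Fin I.n, s.arr 4 i j ≤ m.arr 4 i j) →
      ∀ i j : Fin I.n, (relaxPair.den s).arr 4 i j ≤ m.arr 4 i j :=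
    fun s σ hf hσ hs i j => (hle s σ hf hσ i j).trans (hs i j)
  refine ⟨?_, ?_, ?_⟩
  · exact nest_inv (J := fun a => ∀ i j : Fin I.n, a i j ≤ m.arr 4 i j) _ m hwf h.nodes hJ
      (fun _ => y) fun _ _ => le_rfl
  · refine nest_inv (J := Attained I) _ m hwf h.nodes ?_ (fun _ => y)
    intro s σ hf hσ hs
    rcases step s σ hf hσ with ⟨h1, -⟩ | ⟨h1, h2, h3, h4⟩
    · rwa [h1]
    · intro i j hij
      rw [h4] at hij ⊢
      split_ifs at hij ⊢ with hc
      -- If the new value is at most the bound, so is the old value it came from, and its move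
      -- sequence can be extended.
      · obtain ⟨r, N, h5, h6⟩ := hs (σ 8) (σ 9) (by omega)
        rw [hc.1, hc.2]
        exact ⟨_, _, .step h5 hy0 h1 h2, by omega⟩
      · exact hs i j hij
  · intro u d u' d' hu hd
    refine nest_hit (J := fun a => ∀ i j : Fin I.n, a i j ≤ m.arr 4 i j)
      (Q := fun a => a u' d' ≤ m.arr 4 u d + moveCost I.touch I.col I.start (I.col y) u d)
      [8, 9, 10, 11] m hwf h.nodes hJ (fun s σ hf hσ _ hs => (hle s σ hf hσ u' d').trans hs)
      (fun v => if v = 8 then u else if v = 9 then d else if v = 10 then u' else d') ?_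
      fun _ _ => le_rfl
    intro s hf hσ hs
    have hud := hs u d
    rcases step s _ hf hσ with ⟨h1, h2⟩ | ⟨-, -, h3, h4⟩
    · have h2 := h2 (by simpa using hu) (by simpa using hd)
      simp only [if_true, Nat.reduceEqDiff, if_false] at h2
      rw [h1]
      omega
    · have h4 := h4 u' d'
      simp only [if_true, Nat.reduceEqDiff, if_false, and_self] at h4
      rw [h4]
      omega

theorem relaxColor_spec (h : HoldsTouch I m) {y : Fin I.n} (hy : m.var 5 = y) :
    (∀ u d : Fin I.n, (relaxColor.den m).arr 4 u d ≤ m.arr 4 u d) ∧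
    (Attained I (m.arr 4) → Attained I ((relaxColor.den m).arr 4)) ∧
    (y ≠ I.start → ∀ u d u' d', Move I.touch I.col I.start (I.col y) u u' →
      Move I.touch I.col I.start (I.col y) d d' →
      (relaxColor.den m).arr 4 u' d' ≤
        m.arr 4 u d + moveCost I.touch I.col I.start (I.col y) u d) := by
  classical
  simp only [relaxColor, LoopProg.den]
  rw [if_congr (h.eval_ne_start hy) rfl rfl]
  split_ifs with hy0
  · set e : Expr := .and (ne 7 2) (sameColor 7 5) with he
    have h5 := avoidable_spec h (e := e) (fun x => x ≠ I.start ∧ I.col x = I.col y) (by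
      intro s x hf hx
      have hs := h.frame hf (by decide) (by decide)
      rw [he, Expr.eval_and, hs.eval_ne_start hx,
        hs.eval_sameColor hx (by rw [hf.var 5 (by decide), hy])])
    have h4 : ((avoidable e).den m).arr 4 = m.arr 4 := LoopProg.den_arr (by decide) m
    have := relax_spec (h.den (p := avoidable e) (by decide) (by decide))
      (by rw [LoopProg.den_var (by decide), hy]) hy0 h5
    rw [h4] at this
    exact ⟨this.1, this.2.1, fun _ => this.2.2⟩
  · exact ⟨fun _ _ => le_rfl, fun h => h, fun h => absurd h hy0⟩

theorem relaxColors_spec (h : HoldsTouch I m) {k : ℕ} (h1 : Attained I (m.arr 4))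
    (h2 : BelowCosts I k (m.arr 4)) :
    Attained I (((nest [5] relaxColor).den m).arr 4) ∧
      BelowCosts I (k + 1) (((nest [5] relaxColor).den m).arr 4) := by
  have step : ∀ s (σ : ℕ → Fin I.n), Frame (nest [5] relaxColor) m s →
      (∀ x ∈ [5], s.var x = σ x) → _ := fun s σ hf hσ =>
    relaxColor_spec (h.frame hf (by decide) (by decide)) (hσ 5 (by simp))
  have hwf : (nest [5] relaxColor).wf = true := rfl
  have hJ : ∀ s (σ : ℕ → Fin I.n), Frame (nest [5] relaxColor) m s →
      (∀ x ∈ [5], s.var x = σ x) → BelowCosts I k (s.arr 4) →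
      BelowCosts I k ((relaxColor.den s).arr 4) :=
    fun s σ hf hσ hs r N u d hr hM => ((step s σ hf hσ).1 u d).trans (hs r N u d hr hM)
  refine ⟨nest_inv [5] m hwf h.nodes (fun s σ hf hσ => (step s σ hf hσ).2.1)
    (fun _ => I.start) h1, ?_⟩
  intro r N u d hr hM
  by_cases hrk : r ≤ k
  · exact nest_inv (J := BelowCosts I k) [5] m hwf h.nodes hJ (fun _ => I.start) h2 r N u d hrk hM
  · cases hM with
    | nil => omega
    -- The run for the last moved color `y` handles the last move. Other runs only lower entries, so
    -- the bounds for the first `k` moves are available then.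
    | @step r N u₀ d₀ _ _ y hM hy hu hd =>
      refine nest_hit (J := BelowCosts I k) (Q := fun a => a u d ≤
        N + moveCost I.touch I.col I.start (I.col y) u₀ d₀) [5] m hwf h.nodes hJ
        (fun s σ hf hσ _ hs => ((step s σ hf hσ).1 u d).trans hs) (fun _ => y) ?_ h2
      intro s hf hσ hs
      have h3 := (step s _ hf hσ).2.2 hy u₀ d₀ u d hu hd
      have h4 := hs r N u₀ d₀ (by omega) hM
      omega

theorem rounds_spec (h : HoldsTouch I m) (h1 : Attained I (m.arr 4))
    (h2 : BelowCosts I 0 (m.arr 4)) :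
    Attained I (((nest [4, 5] relaxColor).den m).arr 4) ∧
      BelowCosts I I.n (((nest [4, 5] relaxColor).den m).arr 4) := by
  have main := loop_rule (x := 4) (A := 4) (m := m) (p := nest [5] relaxColor)
    (I := fun k a => Attained I a ∧ BelowCosts I k a) ⟨h1, h2⟩ fun k _ s _ hf ⟨h3, h4⟩ =>
      relaxColors_spec (h.frame hf (by decide) (by decide)) h3 h4
  rwa [h.nodes] at main

/-- The value `I.bound + 1` plays the role of infinity: `Attained` claims nothing about entries
exceeding the bound. -/
theorem costInit_spec (h : HoldsInput I m) :
    Attained I ((costInit.den m).arr 4) ∧ BelowCosts I 0 ((costInit.den m).arr 4) := by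
  have hfill := fill_spec (A := 4) (x := 4) (y := 5) (e := .add (.var 3) (.lit 1))
    (fun _ _ : Fin I.n => I.bound + 1) m rfl h.nodes fun s _ _ hf _ _ => by
      simp [Expr.eval, (h.frame hf (by decide) (by decide)).bound]
  have harr : ∀ i j : Fin I.n, (costInit.den m).arr 4 i j =
      if i = I.start ∧ j = I.start then 0 else I.bound + 1 := by
    intro i j
    simp only [costInit, LoopProg.den, Memory.setArr, Expr.eval, true_and]
    rw [LoopProg.den_var (by decide), h.start]
    simp only [Fin.val_inj, hfill]
  constructor
  · intro u d hud
    rw [harr] at hud ⊢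
    split_ifs at hud ⊢ with hc
    · rw [hc.1, hc.2]
      exact ⟨0, 0, .nil, le_rfl⟩
    · omega
  · intro r N u d hr hM
    cases hM with
    | nil => simp [harr]
    | step => omega

theorem answer_spec (h : HoldsInput I m) (h8 : m.arr 8 I.start I.start = 0) :
    (answer.den m).arr 8 I.start I.start ≠ 0 ↔
      ∃ u d : Fin I.n, ¬ m.arr 5 u d ≠ 0 ∧ m.arr 4 u d + m.arr 7 0 1 ≤ I.bound := by
  rw [answer, mark_spec [4, 5] m (fun σ : ℕ → Fin I.n => ¬ m.arr 5 (σ 4) (σ 5) ≠ 0 ∧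
    m.arr 4 (σ 4) (σ 5) + m.arr 7 0 1 ≤ I.bound) (fun _ => I.start) (fun _ => I.start) rfl h.nodes]
  · constructor
    · rintro (h | ⟨σ, h, -⟩)
      · exact absurd h8 h
      · exact ⟨_, _, h⟩
    · rintro ⟨u, d, h⟩
      exact .inr ⟨fun v => if v = 4 then u else d, by simpa using h, rfl, rfl⟩
  · intro s σ hf hσ
    have hs := h.frame hf (by decide) (by decide)
    refine ⟨?_, hs.start, hs.start⟩
    rw [Expr.eval_and, Expr.eval_not, Expr.eval_not, Expr.eval_lt, Expr.eval,
      eval_entry (hσ 4 (by simp)) (hσ 5 (by simp)), hf.arr 5 (by decide), not_lt, Expr.eval,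
      eval_entry (hσ 4 (by simp)) (hσ 5 (by simp)), hf.arr 4 (by decide), Expr.eval,
      hf.arr 7 (by decide), hs.bound, Expr.eval, Expr.eval]

/-- This direction needs no order, so positive answers are sound on every graph. -/
theorem isYes_of_moveSeq {r N : ℕ} {u d : Fin I.n} (h : MoveSeq I.touch I.col I.start r N u d)
    (hg : IsGoal I.touch u d) (hN : N + (colors I.col I.start).card ≤ I.bound) : I.IsYes := by
  obtain ⟨γ, h1, h2⟩ := exists_conquering_of_moveSeq Touch.refl (fun _ _ => Touch.symm) h hg hN
  exact ⟨γ, h1, by rw [conquered_start, h2]⟩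

theorem exists_moveSeq_of_isYes (hI : IsCocomparability I.graph) (h : I.IsYes) :
    ∃ r N u d, MoveSeq I.touch I.col I.start r N u d ∧ IsGoal I.touch u d ∧ r ≤ I.n ∧
      N + (colors I.col I.start).card ≤ I.bound := by
  obtain ⟨lt, htr, hT⟩ := exists_blockOrder hI I.col I.start
  obtain ⟨γ, h1, h2⟩ := h
  rw [conquered_start] at h2
  obtain ⟨r, N, u, d, h3, h4, h5, h6⟩ := exists_moveSeq_of_conquering Touch.refl
    (fun _ _ => Touch.symm) htr hT
    (fun x y h hx hy hc z hz => Touch.of_block_left (h.block hx hy hc) hz) h2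
  exact ⟨r, N, u, d, h3, h4, by simpa using h5, h1 ▸ h6⟩

theorem solver_spec (hI : IsCocomparability I.graph) :
    (solver.den I.memory).arr 8 I.start I.start ≠ 0 ↔ I.IsYes := by
  have zero : ∀ A ≥ 2, I.memory.arr A = fun _ _ => 0 := by
    intro A hA
    funext i j
    simp [Instance.memory, show A ≠ 0 by omega, show A ≠ 1 by omega]
  set m₁ := blockInit.den I.memory with e1
  set m₂ := (closure 2).den m₁ with e2
  set m₃ := markTouch.den m₂ with e3
  set m₄ := countColors.den m₃ with e4
  set m₅ := costInit.den m₄ with e5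
  set m₆ := (nest [4, 5] relaxColor).den m₅ with e6
  set m₇ := (avoidable (.lit 1)).den m₆ with e7
  have hsolver : solver.den I.memory = answer.den m₇ := rfl
  have h0 := holdsInput_memory I
  have h1 : HoldsInput I m₁ := h0.den (by decide) (by decide)
  have h2 : HoldsInput I m₂ := h1.den (by decide) (by decide)
  have h3 : HoldsTouch I m₃ := ⟨h2.den (by decide) (by decide), touch_spec h2
    (fun i j => by rw [e2, den_arr (by decide), e1, den_arr (by decide), zero 3 (by simp)])
    (block_spec h0)⟩
  have h4 : HoldsTouch I m₄ := h3.den (by decide) (by decide)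
  have h5 : HoldsTouch I m₅ := h4.den (by decide) (by decide)
  have h6 : HoldsTouch I m₆ := h5.den (by decide) (by decide)
  have h7 : HoldsTouch I m₇ := h6.den (by decide) (by decide)
  have hK : m₇.arr 7 0 1 = (colors I.col I.start).card := by
    rw [e7, den_arr (by decide), e6, den_arr (by decide), e5, den_arr (by decide), e4]
    refine countColors_spec h3.toHoldsInput fun i j => ?_
    rw [e3, den_arr (by decide), e2, den_arr (by decide), e1, den_arr (by decide),
      zero 7 (by simp)]
  have h8 : m₇.arr 8 I.start I.start = 0 := by
    rw [e7, den_arr (by decide), e6, den_arr (by decide), e5, den_arr (by decide), e4,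
      den_arr (by decide), e3, den_arr (by decide), e2, den_arr (by decide), e1,
      den_arr (by decide), zero 8 (by simp)]
  have hgoal : ∀ u d : Fin I.n, ¬ m₇.arr 5 u d ≠ 0 ↔ IsGoal I.touch u d := by
    intro u d
    rw [e7, avoidable_spec h6 (fun _ => True) (fun s x _ _ => by simp [Expr.eval])]
    simp [IsGoal]
  obtain ⟨hA, hB⟩ := costInit_spec h4.toHoldsInput
  obtain ⟨hA, hB⟩ := rounds_spec h5 hA hB
  rw [← e6] at hA hB
  have hD : m₇.arr 4 = m₆.arr 4 := den_arr (by decide) m₆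
  rw [hsolver, answer_spec h7.toHoldsInput h8]
  simp only [hgoal, hK, hD]
  constructor
  · rintro ⟨u, d, hg, hb⟩
    obtain ⟨r, N, hM, hN⟩ := hA u d (by omega)
    exact isYes_of_moveSeq hM hg (by omega)
  · intro hy
    obtain ⟨r, N, u, d, hM, hg, hr, hb⟩ := exists_moveSeq_of_isYes hI hy
    have := hB r N u d hr hM
    exact ⟨u, d, hg, by omega⟩

theorem le_size (I : Instance) : I.n ≤ I.size := by
  have := Nat.le_mul_self I.n
  unfold Instance.size
  omega

end HoneyBee

theorem mainTheorem5 :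
    HoneyBee.SolvableInPolyTimeOn
      (fun I => I.graph.Connected ∧ HoneyBee.IsCocomparability I.graph) := by
  classical
  refine ⟨.seq HoneyBee.solver.toProg (.setVar 0 (.bool (.arr 8 (.var 2) (.var 2)))),
    -- The output instruction takes 8 steps: 3 for reading the cell, 2 for each of the two
    -- negations, 1 for the assignment.
    HoneyBee.solver.bound + Polynomial.C 8, fun I ⟨_, hI⟩ => ?_⟩
  obtain ⟨t, ht, hle⟩ := HoneyBee.LoopProg.exec (p := HoneyBee.solver) (by decide) I.memory
  refine ⟨_, _, .seq ht (.setVar _ _ _), ?_, ?_⟩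
  · have h : HoneyBee.solver.bound.eval I.n ≤ HoneyBee.solver.bound.eval I.size :=
      HoneyBee.LoopProg.bound_mono _ (HoneyBee.le_size I)
    replace hle : t ≤ HoneyBee.solver.bound.eval I.n := hle
    simp only [Polynomial.eval_add, Polynomial.eval_C, HoneyBee.Expr.cost, HoneyBee.Expr.bool,
      HoneyBee.Expr.not]
    omega
  · simp only [HoneyBee.Memory.setVar, if_true, HoneyBee.Expr.eval_bool]
    refine if_congr ?_ rfl rfl
    rw [← HoneyBee.solver_spec hI]
    have h2 : (HoneyBee.solver.den I.memory).var 2 = I.start :=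
      HoneyBee.LoopProg.den_var (by decide) I.memory
    simp only [HoneyBee.Expr.eval, h2]
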